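/- For a partition $\lambda=(\lambda_1\ge\lambda_2\ge\dots\ge 0)$ of size $|\lambda|$, let $\dim\lambda$ be the number of chains of partitions $\lambda=\lambda^{(0)}\searrow\lambda^{(1)}\searrow\dots\searrow\lambda^{(|\lambda|)}=\emptyset$ in which each $\lambda^{(i+1)}$ is obtained from $\lambda^{(i)}$ by removing one square (that is, the number of standard Young tableaux of shape $\lambda$), and let $$\mathfrak S(\lambda)=\{\lambda_i-i+\tfrac12 : i=1,2,3,\dots\}\subset\mathbb Z+\tfrac12 .$$ Let $\xi>0$. Then $$P_{PP}(\lambda)=e^{-\xi}\,\xi^{|\lambda|}\left(\frac{\dim\lambda}{|\lambda|!}\right)^2$$ defines a probability measure on the set of all partitions (the Poissonized Plancherel measure), and for every finite set $X=\{x_1,\dots,x_n\}\subset\mathbb Z+\tfrac12$ of $n\ge 0$ distinct points $$P_{PP}\big(X\subset\mathfrak S(\lambda)\big)=\det\big[K_{Bessel}(x_i,x_j;\xi)\big]_{i,j=1,\dots,n},$$ where $K_{Bessel}$ is the discrete Bessel kernel $$K_{Bessel}(x,y;\xi)=\frac1{(2\pi i)^2}\oint_{|z|=R}\oint_{|w|=r}\frac{e^{\sqrt\xi\,(z-z^{-1}-w+w^{-1})}}{z-w}\,\frac{dw\,dz}{z^{x+\frac12}\,w^{-y+\frac12}},\qquad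 x,y\in\mathbb Z+\tfrac12,$$ with positively oriented circles of arbitrary radii $R>r>0$. Moreover, for all $x\neq y$ in $\mathbb Z+\tfrac12$, $$K_{Bessel}(x,y;\xi)=\sqrt\xi\;\frac{J_{x-\frac12}J_{y+\frac12}-J_{x+\frac12}J_{y-\frac12}}{x-y},$$ where $J_n=J_n(2\sqrt\xi)$ is the Bessel function of integral order $n$, defined as the coefficient of $z^n$ in the Laurent series $e^{\frac t2(z-z^{-1})}=\sum_{n\in\mathbb Z}J_n(t)\,z^n$, $z\ne0$. -/

import Mathlib

open MeasureTheory Real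
open scoped Nat

noncomputable section

/-- The lattice `ℤ + 1/2` of half-integers, as a subset of the real line. -/
abbrev HalfInt : Type := {x : ℝ // ∃ k : ℤ, x = (k : ℝ) + 1 / 2}

/-- `dim lam`: the number of chains of partitions
`lam = c 0 ↘ c 1 ↘ ⋯ ↘ c N = ∅`, `N = |lam|`, in which each `c (i + 1)` is obtained from `c i` by
removing one square. Equivalently, the number of standard Young tableaux of shape `lam`. -/
def dimDiagram (lam : YoungDiagram) : ℕ :=
  Nat.card {c : Fin (lam.card + 1) → YoungDiagram //
    c 0 = lam ∧ c (Fin.last lam.card) = ⊥ ∧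
      ∀ i : Fin lam.card, c i.succ ≤ c i.castSucc ∧ (c i.castSucc).card = (c i.succ).card + 1}

/-- `𝔖(lam) = {lam_i - i + 1/2 : i = 1, 2, …}`; Mathlib numbers the rows from `0`, so that
`lam_{i+1} = lam.rowLen i`. -/
def downSet (lam : YoungDiagram) : Set HalfInt :=
  {s | ∃ i : ℕ, (s : ℝ) = (lam.rowLen i : ℝ) - ((i : ℝ) + 1) + 1 / 2}

/-- The weight `e^{-ξ} ξ^{|lam|} (dim lam / |lam|!)²`. -/
def poissonPlancherelWeight (ξ : ℝ) (lam : YoungDiagram) : ℝ :=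
  Real.exp (-ξ) * ξ ^ lam.card * ((dimDiagram lam : ℝ) / (lam.card ! : ℝ)) ^ 2

/-- Every set of partitions is measurable. -/
instance : MeasurableSpace YoungDiagram := ⊤

/-- The Poissonized Plancherel measure on the set of all partitions. -/
def poissonPlancherel (ξ : ℝ) : Measure YoungDiagram :=
  Measure.sum fun lam => ENNReal.ofReal (poissonPlancherelWeight ξ lam) • Measure.dirac lam

/-- The Bessel function `J_n(t)` of integral order `n`: the `n`-th coefficient of the Laurent series
of `z ↦ exp ((t / 2) (z - z⁻¹))` on `ℂ ∖ {0}`, see `hasSum_besselJ`. -/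
def besselJ (n : ℤ) (t : ℂ) : ℂ :=
  (2 * π * Complex.I)⁻¹ *
    ∮ z in C(0, 1), Complex.exp (t / 2 * (z - z⁻¹)) * z ^ (-n - 1)

/-- The discrete Bessel kernel: the double contour integral over the positively oriented circles
`|z| = R` and `|w| = r`, to be used with `0 < r < R`. The exponents `x + 1/2` and `-y + 1/2` are
integers, so that the floors below are exact. -/
def besselKernel (R r ξ : ℝ) (x y : HalfInt) : ℂ :=
  ((2 * π * Complex.I) ^ 2)⁻¹ *
    ∮ z in C(0, R), ∮ w in C(0, r),
      Complex.exp ((√ξ : ℂ) * (z - z⁻¹ - w + w⁻¹)) / (z - w) *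
        (1 / (z ^ ⌊(x : ℝ) + 1 / 2⌋ * w ^ ⌊-(y : ℝ) + 1 / 2⌋))

/-- The Laurent expansion `exp ((t / 2) (z - z⁻¹)) = ∑ₙ J_n(t) zⁿ`. -/
theorem hasSum_besselJ (t z : ℂ) (hz : z ≠ 0) :
    HasSum (fun n : ℤ => besselJ n t * z ^ n) (Complex.exp (t / 2 * (z - z⁻¹))) := by
  obtain ⟨a, ha⟩ : ∃ a : ℤ → ℂ, ∀ z : ℂ, z ≠ 0 →
      HasSum (fun n : ℤ => a n * z ^ n) (Complex.exp (t / 2 * (z - z⁻¹))) := by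
    let f : ℕ × ℕ → ℂ := fun p => (t / 2) ^ p.1 / (p.1 ! : ℂ) * ((-(t / 2)) ^ p.2 / (p.2 ! : ℂ))
    let d : ℕ × ℕ → ℤ := fun p => (p.1 : ℤ) - p.2
    refine ⟨fun n => ∑' p : {p : ℕ × ℕ // d p = n}, f p, fun z hz => ?_⟩
    have h1 : HasSum (fun p : ℕ × ℕ => f p * z ^ d p) (Complex.exp (t / 2 * (z - z⁻¹))) := by
      have e (u : ℂ) : HasSum (fun n : ℕ => u ^ n / (n ! : ℂ)) (Complex.exp u) := by
        rw [Complex.exp_eq_exp_ℂ]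
        exact NormedSpace.expSeries_div_hasSum_exp u
      have hs := summable_mul_of_summable_norm
        (NormedSpace.norm_expSeries_div_summable (𝔸 := ℂ) (t / 2 * z))
        (NormedSpace.norm_expSeries_div_summable (𝔸 := ℂ) (-(t / 2) * z⁻¹))
      have hm := (e (t / 2 * z)).mul (e (-(t / 2) * z⁻¹)) hs
      rw [← Complex.exp_add, show t / 2 * z + -(t / 2) * z⁻¹ = t / 2 * (z - z⁻¹) by ring] at hm
      refine hm.congr_fun fun p => ?_
      simp only [f, d, zpow_sub₀ hz, zpow_natCast, mul_pow, inv_pow]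
      field_simp
    have h2 := ((Equiv.sigmaFiberEquiv d).hasSum_iff).mpr h1
    have h3 := h2.sigma (γ := fun n => {p : ℕ × ℕ // d p = n})
      (g := fun n => (∑' p : {p : ℕ × ℕ // d p = n}, f p) * z ^ n) (fun n => ?_)
    · exact h3
    · have hsn := (h2.summable.sigma_factor n).hasSum
      have : (fun c : {p : ℕ × ℕ // d p = n} =>
          ((fun p : ℕ × ℕ => f p * z ^ d p) ∘ (Equiv.sigmaFiberEquiv d)) ⟨n, c⟩) =
          fun c : {p : ℕ × ℕ // d p = n} => f c * z ^ n := by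
        funext c
        obtain ⟨p, rfl⟩ := c
        rfl
      rw [this] at hsn ⊢
      rwa [tsum_mul_right] at hsn
  have key : ∀ n, besselJ n t = a n := by
    intro n
    have hsum : Summable fun m : ℤ => ‖a m‖ := by
      have h := (ha 1 one_ne_zero).summable.norm
      simpa using h
    have hterm : ∀ m : ℤ, (∮ z in C(0, 1), a m * z ^ m * z ^ (-n - 1)) =
        if m = n then 2 * π * Complex.I * a n else 0 := by
      intro m
      have hc : (∮ z in C(0, 1), a m * z ^ m * z ^ (-n - 1)) =
          ∮ z in C(0, 1), a m * (z - 0) ^ (m - n - 1) := by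
        refine circleIntegral.integral_congr zero_le_one fun z hz => ?_
        have hz0 : z ≠ 0 := by
          rintro rfl
          simp at hz
        simp only [sub_zero, mul_assoc, ← zpow_add₀ hz0]
        congr 2
        ring
      rw [hc, circleIntegral.integral_const_mul]
      split_ifs with h
      · subst h
        simp only [sub_self, zero_sub, zpow_neg_one]
        rw [circleIntegral.integral_sub_center_inv 0 one_ne_zero]
        ring
      · rw [circleIntegral.integral_sub_zpow_of_ne (by omega), mul_zero]
    have hI : HasSum (fun m : ℤ => ∮ z in C(0, 1), a m * z ^ m * z ^ (-n - 1))
        (∮ z in C(0, 1), Complex.exp (t / 2 * (z - z⁻¹)) * z ^ (-n - 1)) := by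
      refine intervalIntegral.hasSum_integral_of_dominated_convergence
        (bound := fun m _ => ‖a m‖) (fun m => ?_) (fun m => ?_) ?_ ?_ ?_
      · refine Continuous.aestronglyMeasurable ?_
        have hne : ∀ θ : ℝ, circleMap 0 1 θ ≠ 0 := fun θ => circleMap_ne_center one_ne_zero
        simp only [deriv_circleMap, smul_eq_mul]
        have hcm : Continuous (circleMap 0 1) := continuous_circleMap 0 1
        exact (hcm.mul continuous_const).mul ((continuous_const.mul
          (hcm.zpow₀ m fun θ => Or.inl (hne θ))).mul (hcm.zpow₀ _ fun θ => Or.inl (hne θ)))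
      · filter_upwards with θ _
        simp
      · filter_upwards with θ _ using hsum
      · exact intervalIntegrable_const
      · filter_upwards with θ _
        have hne : circleMap 0 1 θ ≠ 0 := circleMap_ne_center one_ne_zero
        exact ((ha _ hne).mul_right _).const_smul _
    simp only [hterm] at hI
    have hJ := hI.unique (hasSum_ite_eq n (2 * π * Complex.I * a n))
    rw [besselJ, hJ, inv_mul_cancel_left₀ Complex.two_pi_I_ne_zero]
  simpa only [key] using ha z hz

end

/-! Put t = √ξ. The branching rule of Young's lattice gives t^|λ| dim λ / |λ|! = det[t^(λ_i - i + j)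
/ (λ_i - i + j)!] for diagrams with at most N rows (`jacobiTrudiDet_eq`), so e^ξ times the weight is
the square of an N × N minor. Strictly decreasing integer tuples with a nonzero minor are exactly
the tuples (λ_i - i) that come from such diagrams. Restricted to these diagrams, the measure is
therefore a biorthogonal ensemble: by Cauchy–Binet its total mass is e^(-ξ) det G_N, and its
correlations are det G_N times determinants of a kernel built from G_N⁻¹
(`sum_strictAnti_det_sq_mem_range`, `hasSum_diagram_det`).

The number t^(s+j)/(s+j)! is the s-th Fourier coefficient of z^(-j) e^(tz) on the unit circle. Thus
G_N is the Gram matrix of these functions for 0 ≤ j < N, and the kernel is the matrix, in the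
Fourier basis, of the orthogonal projection onto their span.

As N grows, these projections converge strongly to the projection onto the closed span of all z^(-k)
e^(tz), k ≥ 0. Multiplication by e^(-t/z) and by its inverse involves only nonnegative powers of
1/z, so the same closed space is spanned by z^(-k) e^(t(z-1/z)). The factor e^(t(z-1/z)) is
unimodular on the circle, so these vectors are orthonormal; their Fourier coefficients are Bessel
functions, and the limiting kernel is ∑_{k≥0} J_{a+k} J_{b+k} (`inner_starProjection_closure`). The
case n = 0 shows det G_N → e^ξ, which fixes the normalization.

Expanding 1/(z - w) geometrically turns the double contour integral into the same sum, and the three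
term recurrence makes (a - b) times the sum telescope to the closed formula. -/

open MeasureTheory Real
open scoped Nat

noncomputable section

/-! ### Cauchy–Binet and finite determinantal ensembles -/

section CauchyBinet

open Finset

/-- Injective tuples are the rearrangements of strictly decreasing ones. -/
theorem sum_injective_eq_sum_strictAnti_perm {α R : Type*} [LinearOrder α] [AddCommMonoid R]
    {N : ℕ} (W : Finset α) (F : (Fin N → α) → R) :
    ∑ f ∈ Fintype.piFinset (fun _ : Fin N => W) with Function.Injective f, F f =
      ∑ g ∈ Fintype.piFinset (fun _ : Fin N => W) with StrictAnti g,
        ∑ σ : Equiv.Perm (Fin N), F (g ∘ σ) := by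
  rw [← Finset.sum_product' (f := fun g (σ : Equiv.Perm (Fin N)) => F (g ∘ σ))]
  symm
  refine Finset.sum_bij (fun p _ => p.1 ∘ p.2) ?_ ?_ ?_ ?_
  · rintro ⟨g, σ⟩ h
    simp only [mem_product, mem_filter, Fintype.mem_piFinset, mem_univ, and_true] at h ⊢
    exact ⟨fun i => h.1 _, h.2.injective.comp σ.injective⟩
  · rintro ⟨g, σ⟩ h ⟨g', σ'⟩ h' he
    simp only [mem_product, mem_filter, Fintype.mem_piFinset, mem_univ, and_true] at h h' he
    have hr : Set.range g = Set.range g' := by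
      have := congrArg Set.range he
      rwa [EquivLike.range_comp, EquivLike.range_comp] at this
    have hg : g = g' := by
      have h1 : StrictMono (OrderDual.toDual ∘ g) := h.2
      have h2 : StrictMono (OrderDual.toDual ∘ g') := h'.2
      have := (StrictMono.range_inj h1 h2).1 (by rw [Set.range_comp, Set.range_comp, hr])
      funext i
      exact congrFun this i
    subst hg
    have : σ = σ' := by
      ext i
      exact congrArg Fin.val (h.2.injective (congrFun he i))
    rw [this]
  · intro f hf
    simp only [mem_filter, Fintype.mem_piFinset] at hf
    -- Sorting in the dual order makes `f ∘ σ` decreasing.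
    let σ := Tuple.sort (OrderDual.toDual ∘ f)
    refine ⟨⟨f ∘ σ, σ⁻¹⟩, ?_, ?_⟩
    · simp only [mem_product, mem_filter, Fintype.mem_piFinset, mem_univ, and_true]
      refine ⟨fun i => hf.1 _, ?_⟩
      have hm : Antitone (f ∘ σ) := Tuple.monotone_sort (OrderDual.toDual ∘ f)
      exact hm.strictAnti_of_injective (hf.2.comp σ.injective)
    · funext i
      simp
  · intros
    rfl

/-- The Cauchy–Binet formula, with the minors indexed by strictly decreasing tuples. -/
theorem det_sum_mul_eq_sum_strictAnti {α R : Type*} [LinearOrder α] [CommRing R] {N : ℕ}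
    (W : Finset α) (A B : Fin N → α → R) :
    Matrix.det (Matrix.of fun i j => ∑ s ∈ W, A i s * B j s) =
      ∑ g ∈ Fintype.piFinset (fun _ : Fin N => W) with StrictAnti g,
        Matrix.det (Matrix.of fun i j => A i (g j)) * Matrix.det (Matrix.of fun i j => B i (g j)) := by
  have h1 : Matrix.det (Matrix.of fun i j => ∑ s ∈ W, A i s * B j s) =
      ∑ f ∈ Fintype.piFinset (fun _ : Fin N => W),
        (∏ j, B j (f j)) * Matrix.det (Matrix.of fun i j => A i (f j)) := by
    simp only [Matrix.det_apply', Matrix.of_apply, Finset.prod_univ_sum, Finset.mul_sum]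
    rw [Finset.sum_comm]
    refine Finset.sum_congr rfl fun f _ => Finset.sum_congr rfl fun σ _ => ?_
    rw [Finset.prod_mul_distrib]
    ring
  -- A repeated value of `f` produces two equal columns.
  have h2 : ∑ f ∈ Fintype.piFinset (fun _ : Fin N => W),
        (∏ j, B j (f j)) * Matrix.det (Matrix.of fun i j => A i (f j)) =
      ∑ f ∈ Fintype.piFinset (fun _ : Fin N => W) with Function.Injective f,
        (∏ j, B j (f j)) * Matrix.det (Matrix.of fun i j => A i (f j)) := by
    symm
    apply Finset.sum_filter_of_ne
    intro f _ hne
    by_contra hinj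
    simp only [Function.Injective, not_forall] at hinj
    obtain ⟨i, j, hij, hne'⟩ := hinj
    exact hne (by rw [Matrix.det_zero_of_column_eq hne' fun k => by simp [hij], mul_zero])
  rw [h1, h2, sum_injective_eq_sum_strictAnti_perm]
  refine Finset.sum_congr rfl fun g _ => ?_
  have h3 : ∀ σ : Equiv.Perm (Fin N), Matrix.det (Matrix.of fun i j => A i ((g ∘ σ) j)) =
      (Equiv.Perm.sign σ : ℤ) * Matrix.det (Matrix.of fun i j => A i (g j)) := fun σ =>
    Matrix.det_permute' σ (Matrix.of fun i j => A i (g j))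
  simp only [h3]
  rw [← Matrix.det_transpose (Matrix.of fun i j => B i (g j)),
    Matrix.det_apply' (Matrix.transpose _), Finset.mul_sum]
  refine Finset.sum_congr rfl fun σ _ => ?_
  simp only [Matrix.transpose_apply, Matrix.of_apply, Function.comp_apply]
  ring

open Classical in
/-- The correlation functions of a finite biorthogonal ensemble are determinants. -/
theorem sum_strictAnti_det_sq_mem_range {α : Type*} [LinearOrder α] {N n : ℕ}
    (W : Finset α) (A : Fin N → α → ℂ) (x : Fin n → α) (hx : Function.Injective x)
    (hxW : ∀ k, x k ∈ W) (G : Matrix (Fin N) (Fin N) ℂ)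
    (hG : G = Matrix.of fun i j => ∑ s ∈ W, A i s * A j s) (hdet : G.det ≠ 0) :
    ∑ g ∈ Fintype.piFinset (fun _ : Fin N => W) with StrictAnti g,
        Matrix.det (Matrix.of fun i j => A i (g j)) ^ 2 *
          (if Set.range x ⊆ Set.range g then 1 else 0) =
      G.det * Matrix.det (Matrix.of fun k l : Fin n => ∑ i, ∑ j, A i (x k) * G⁻¹ i j * A j (x l)) := by
  set K : Matrix (Fin n) (Fin n) ℂ :=
    Matrix.of fun k l : Fin n => ∑ i, ∑ j, A i (x k) * G⁻¹ i j * A j (x l) with hK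
  set U : Matrix (Fin N) (Fin n) ℂ := Matrix.of fun i k => A i (x k) with hU
  let c : (Fin N → α) → ℕ := fun g => #{i | g i ∈ Set.range x}
  have hKU : K = U.transpose * G⁻¹ * U := by
    ext k l
    simp only [hK, hU, Matrix.mul_apply, Matrix.of_apply, Matrix.transpose_apply, Finset.sum_mul]
    rw [Finset.sum_comm]
  have hc : ∀ g : Fin N → α, StrictAnti g → c g ≤ n ∧ (c g = n ↔ Set.range x ⊆ Set.range g) := by
    intro g hg
    have hcard : c g = #((univ.image g) ∩ (univ.image x)) := by
      have : (univ.image g) ∩ (univ.image x) = ({i | g i ∈ Set.range x} : Finset (Fin N)).image g := by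
        ext s
        simp only [mem_inter, mem_image, mem_univ, true_and, mem_filter, Set.mem_range]
        constructor
        · rintro ⟨⟨i, rfl⟩, k, hk⟩
          exact ⟨i, ⟨k, hk⟩, rfl⟩
        · rintro ⟨i, ⟨k, hk⟩, rfl⟩
          exact ⟨⟨i, rfl⟩, k, hk⟩
      rw [this, Finset.card_image_of_injective _ hg.injective]
    have hn : #(univ.image x) = n := by
      rw [Finset.card_image_of_injective _ hx, Finset.card_univ, Fintype.card_fin]
    refine ⟨by rw [hcard]; exact (card_le_card inter_subset_right).trans hn.le, ?_⟩
    rw [hcard]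
    have hsub : Set.range x ⊆ Set.range g ↔ univ.image x ⊆ univ.image g := by
      rw [← Finset.coe_subset]
      simp
    rw [hsub]
    constructor
    · intro h
      have := Finset.eq_of_subset_of_card_le
        (inter_subset_right (s₁ := univ.image g) (s₂ := univ.image x)) (by rw [h, hn])
      rw [← this]
      exact inter_subset_left
    · intro h
      rw [inter_eq_right.2 h, hn]
  -- Each entry of `g` lying in the range of `x` receives the weight 1 + ε⁻¹. After multiplication
  -- by ε^n the term of `g` carries ε^(n-c)(ε+1)^c, which at ε = 0 becomes the indicator of c = n,
  -- that is, of `g` covering `x`.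
  have key : ∀ ε : ℂ, ε ≠ 0 →
      ∑ g ∈ Fintype.piFinset (fun _ : Fin N => W) with StrictAnti g,
        Matrix.det (Matrix.of fun i j => A i (g j)) ^ 2 * (ε ^ (n - c g) * (ε + 1) ^ c g) =
      G.det * Matrix.det (ε • (1 : Matrix (Fin n) (Fin n) ℂ) + K) := by
    intro ε hε
    have hcb := det_sum_mul_eq_sum_strictAnti W
      (fun i s => (1 + ε⁻¹ * if s ∈ Set.range x then 1 else 0) * A i s) A
    have hl : (Matrix.of fun i j => ∑ s ∈ W,
        (1 + ε⁻¹ * if s ∈ Set.range x then 1 else 0) * A i s * A j s) =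
        G + (ε⁻¹ • U) * U.transpose := by
      ext i j
      simp only [hG, hU, Matrix.of_apply, Matrix.add_apply, Matrix.mul_apply, Matrix.smul_apply,
        Matrix.transpose_apply, smul_eq_mul, add_mul, one_mul, Finset.sum_add_distrib]
      congr 1
      have : ∑ k, ε⁻¹ * A i (x k) * A j (x k) =
          ∑ s ∈ univ.image x, ε⁻¹ * A i s * A j s := by
        rw [Finset.sum_image fun _ _ _ _ h => hx h]
      rw [this]
      have hsub : univ.image x ⊆ W := by
        intro s hs
        obtain ⟨k, -, rfl⟩ := mem_image.1 hs
        exact hxW k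
      rw [← Finset.sum_subset hsub]
      · refine Finset.sum_congr rfl fun s hs => ?_
        have : s ∈ Set.range x := by simpa using hs
        simp [this]
      · intro s _ hs
        have : s ∉ Set.range x := by simpa using hs
        simp [this]
    -- The weights perturb `G` by the product of an N × n and an n × N matrix, so det(G + UV) = det
    -- G · det(1 + V G⁻¹ U) leaves an n × n determinant.
    rw [hl, Matrix.det_add_mul _ _ (isUnit_iff_ne_zero.2 hdet)] at hcb
    have hr : ε • (1 : Matrix (Fin n) (Fin n) ℂ) + K =
        ε • (1 + U.transpose * G⁻¹ * (ε⁻¹ • U)) := by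
      rw [hKU, smul_add, Matrix.mul_smul, smul_smul, mul_inv_cancel₀ hε, one_smul]
    rw [hr, Matrix.det_smul, Fintype.card_fin, mul_left_comm, hcb, Finset.mul_sum]
    refine Finset.sum_congr rfl fun g hg => ?_
    have hcg := (hc g (mem_filter.1 hg).2).1
    have hd : Matrix.det (Matrix.of fun i j =>
        (1 + ε⁻¹ * if g j ∈ Set.range x then 1 else 0) * A i (g j)) =
        (1 + ε⁻¹) ^ c g * Matrix.det (Matrix.of fun i j => A i (g j)) := by
      have := Matrix.det_mul_row (fun j => (1 + ε⁻¹ * if g j ∈ Set.range x then (1 : ℂ) else 0))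
        (Matrix.of fun i j => A i (g j))
      simp only [Matrix.of_apply] at this
      rw [this]
      congr 1
      have : ∀ j, (1 + ε⁻¹ * if g j ∈ Set.range x then (1 : ℂ) else 0) =
          if g j ∈ Set.range x then 1 + ε⁻¹ else 1 := by
        intro j
        split_ifs <;> simp
      simp only [this]
      rw [Finset.prod_ite]
      simp [c]
    rw [hd]
    have : ε ^ n = ε ^ (n - c g) * ε ^ c g := by rw [← pow_add, Nat.sub_add_cancel hcg]
    have h2 : (ε + 1) ^ c g = ε ^ c g * (1 + ε⁻¹) ^ c g := by
      rw [← mul_pow, mul_add, mul_inv_cancel₀ hε, mul_one]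
    rw [this, h2]
    ring
  have hL : Continuous fun ε : ℂ =>
      ∑ g ∈ Fintype.piFinset (fun _ : Fin N => W) with StrictAnti g,
        Matrix.det (Matrix.of fun i j => A i (g j)) ^ 2 * (ε ^ (n - c g) * (ε + 1) ^ c g) := by
    fun_prop
  have hR : Continuous fun ε : ℂ => G.det * Matrix.det (ε • (1 : Matrix (Fin n) (Fin n) ℂ) + K) :=
    continuous_const.mul (Continuous.matrix_det (by fun_prop))
  -- The division by ε excluded ε = 0; both sides are continuous, so the identity extends there.
  have h0 := congrFun (Continuous.ext_on (dense_compl_singleton (0 : ℂ)) hL hR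
    fun ε hε => key ε hε) 0
  simp only [zero_smul, zero_add, one_pow, mul_one] at h0
  rw [← h0]
  refine Finset.sum_congr rfl fun g hg => ?_
  obtain ⟨h1, h2⟩ := hc g (mem_filter.1 hg).2
  congr 1
  split_ifs with h
  · rw [h2.2 h, Nat.sub_self, pow_zero]
  · have : n - c g ≠ 0 := by
      have := mt h2.1 h
      omega
    rw [zero_pow this]

end CauchyBinet

/-! ### Young's lattice: adding and removing squares -/

namespace YoungDiagram

open Finset

theorem ext_rowLen {lam mu : YoungDiagram} (h : ∀ i, lam.rowLen i = mu.rowLen i) : lam = mu := by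
  ext ⟨i, j⟩
  rw [mem_cells, mem_cells, mem_iff_lt_rowLen, mem_iff_lt_rowLen, h]

theorem le_iff_rowLen_le {lam mu : YoungDiagram} :
    lam ≤ mu ↔ ∀ i, lam.rowLen i ≤ mu.rowLen i := by
  constructor
  · intro h i
    by_contra! hlt
    have h1 : (i, mu.rowLen i) ∈ lam := mem_iff_lt_rowLen.2 hlt
    exact lt_irrefl _ (mem_iff_lt_rowLen.1 (h h1))
  · rintro h ⟨i, j⟩ hij
    exact mem_iff_lt_rowLen.2 ((mem_iff_lt_rowLen.1 hij).trans_le (h i))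

theorem rowLen_bot (i : ℕ) : (⊥ : YoungDiagram).rowLen i = 0 := by
  by_contra h
  exact notMem_bot _ (mem_iff_lt_rowLen.2 (Nat.pos_of_ne_zero h))

theorem rowLen_pos_iff {lam : YoungDiagram} {i : ℕ} : 0 < lam.rowLen i ↔ i < lam.colLen 0 := by
  rw [← mem_iff_lt_rowLen, mem_iff_lt_colLen]

theorem rowLen_colLen_zero (lam : YoungDiagram) : lam.rowLen (lam.colLen 0) = 0 := by
  by_contra h
  exact lt_irrefl _ (rowLen_pos_iff.1 (Nat.pos_of_ne_zero h))

theorem rowLen_eq_zero_of_le {lam : YoungDiagram} {N i : ℕ} (h : lam.rowLen N = 0) (hi : N ≤ i) :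
    lam.rowLen i = 0 :=
  Nat.eq_zero_of_le_zero (h ▸ lam.rowLen_anti N i hi)

/-- The diagram with prescribed row lengths. -/
def ofAntitone (r : ℕ → ℕ) (hr : Antitone r) (N : ℕ) : YoungDiagram where
  cells := (range N ×ˢ range (r 0)).filter fun c => c.2 < r c.1
  isLowerSet := by
    rintro ⟨i, j⟩ ⟨i', j'⟩ ⟨hi, hj⟩ h
    simp only [coe_filter, mem_product, mem_range, Set.mem_ofPred_eq] at h hi hj ⊢
    have := hr hi
    have := hr (Nat.zero_le i')
    omega

theorem rowLen_ofAntitone {r : ℕ → ℕ} (hr : Antitone r) {N : ℕ} (hN : r N = 0) (i : ℕ) :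
    (ofAntitone r hr N).rowLen i = r i := by
  have h : ∀ j, j < (ofAntitone r hr N).rowLen i ↔ j < r i := by
    intro j
    rw [← mem_iff_lt_rowLen, ← mem_cells, ofAntitone]
    simp only [mem_filter, mem_product, mem_range]
    refine ⟨fun h => h.2, fun h => ⟨⟨?_, h.trans_le (hr (Nat.zero_le i))⟩, h⟩⟩
    by_contra! hi
    have := hr hi
    omega
  exact le_antisymm (by by_contra! hlt; exact lt_irrefl _ ((h _).1 hlt))
    (by by_contra! hlt; exact lt_irrefl _ ((h _).2 hlt))

theorem card_eq_sum_rowLen {lam : YoungDiagram} {N : ℕ} (h : lam.rowLen N = 0) :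
    lam.card = ∑ i ∈ range N, lam.rowLen i := by
  rw [YoungDiagram.card, Finset.card_eq_sum_card_fiberwise (f := Prod.fst) (t := range N)]
  · exact Finset.sum_congr rfl fun i _ => (lam.rowLen_eq_card).symm
  · rintro ⟨i, j⟩ hc
    have h1 : j < lam.rowLen i := mem_iff_lt_rowLen.1 hc
    simp only [coe_range, Set.mem_Iio]
    by_contra! hi
    rw [rowLen_eq_zero_of_le h hi] at h1
    omega

theorem eq_bot_of_card_eq_zero {lam : YoungDiagram} (h : lam.card = 0) : lam = ⊥ := by
  ext c
  rw [Finset.card_eq_zero.1 h, cells_bot]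

theorem eq_of_le_of_card_le {lam mu : YoungDiagram} (h : lam ≤ mu) (hc : mu.card ≤ lam.card) :
    lam = mu := by
  ext1
  exact Finset.eq_of_subset_of_card_le (cells_subset_iff.2 h) hc

theorem card_sup_add_card_inf (lam mu : YoungDiagram) :
    (lam ⊔ mu).card + (lam ⊓ mu).card = lam.card + mu.card := by
  simp only [YoungDiagram.card, cells_sup, cells_inf, Finset.card_union_add_card_inter]

/-- `lam` is obtained from `mu` by adding one square. -/
def IsBoxAdd (mu lam : YoungDiagram) : Prop := mu ≤ lam ∧ lam.card = mu.card + 1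

theorem isBoxAdd_iff {mu lam : YoungDiagram} :
    IsBoxAdd mu lam ↔ ∃ i, ∀ k, lam.rowLen k = mu.rowLen k + if k = i then 1 else 0 := by
  set N := max (mu.colLen 0) (lam.colLen 0) with hN
  have h1 : mu.rowLen N = 0 := rowLen_eq_zero_of_le mu.rowLen_colLen_zero (le_max_left _ _)
  have h2 : lam.rowLen N = 0 := rowLen_eq_zero_of_le lam.rowLen_colLen_zero (le_max_right _ _)
  constructor
  · rintro ⟨hle, hc⟩
    rw [le_iff_rowLen_le] at hle
    rw [card_eq_sum_rowLen h1, card_eq_sum_rowLen h2] at hc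
    have hs : ∑ i ∈ range N, (lam.rowLen i - mu.rowLen i) = 1 := by
      rw [Finset.sum_tsub_distrib _ fun i _ => hle i, hc]
      omega
    obtain ⟨i, hi, hpos⟩ : ∃ i ∈ range N, lam.rowLen i - mu.rowLen i ≠ 0 := by
      by_contra! hz
      rw [Finset.sum_eq_zero hz] at hs
      omega
    refine ⟨i, fun k => ?_⟩
    have hi' := Finset.add_sum_erase (range N) (fun i => lam.rowLen i - mu.rowLen i) hi
    simp only [hs] at hi'
    have hlei := hle i
    split_ifs with hk
    · subst hk
      omega
    · by_cases hkN : k ∈ range N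
      · have := Finset.single_le_sum (f := fun i => lam.rowLen i - mu.rowLen i)
          (fun _ _ => Nat.zero_le _) (Finset.mem_erase.2 ⟨hk, hkN⟩)
        have := hle k
        omega
      · rw [mem_range, not_lt] at hkN
        rw [rowLen_eq_zero_of_le h1 hkN, rowLen_eq_zero_of_le h2 hkN]
  · rintro ⟨i, hi⟩
    refine ⟨le_iff_rowLen_le.2 fun k => by rw [hi k]; omega, ?_⟩
    rw [card_eq_sum_rowLen h1, card_eq_sum_rowLen h2]
    simp only [hi, Finset.sum_add_distrib]
    rw [Finset.sum_ite_eq', if_pos]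
    rw [mem_range]
    by_contra! hNi
    have := hi i
    rw [rowLen_eq_zero_of_le h2 hNi] at this
    simp at this

/-- The rows whose last square can be removed. -/
def removableRows (lam : YoungDiagram) : Finset ℕ :=
  (range (lam.colLen 0)).filter fun i => lam.rowLen (i + 1) < lam.rowLen i

theorem mem_removableRows {lam : YoungDiagram} {i : ℕ} :
    i ∈ lam.removableRows ↔ lam.rowLen (i + 1) < lam.rowLen i := by
  rw [removableRows, mem_filter, mem_range, ← rowLen_pos_iff]
  omega

/-- The rows at the end of which a square can be added. -/
def addableRows (lam : YoungDiagram) : Finset ℕ :=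
  insert 0 (lam.removableRows.map ⟨Nat.succ, Nat.succ_injective⟩)

/-- The addable rows are row 0 and the rows just below removable ones. This excess of one is the
source of the commutation relation behind `sum_up_dimDiagram`. -/
theorem card_addableRows (lam : YoungDiagram) :
    #lam.addableRows = #lam.removableRows + 1 := by
  rw [addableRows, card_insert_of_notMem (by simp), card_map]

theorem mem_addableRows {lam : YoungDiagram} {i : ℕ} :
    i ∈ lam.addableRows ↔ i = 0 ∨ lam.rowLen i < lam.rowLen (i - 1) := by
  rw [addableRows, mem_insert, mem_map]
  simp only [mem_removableRows, Function.Embedding.coeFn_mk]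
  constructor
  · rintro (h | ⟨k, hk, rfl⟩)
    · exact Or.inl h
    · exact Or.inr (by simpa using hk)
  · rintro (h | h)
    · exact Or.inl h
    · obtain _ | k := i
      · exact Or.inl rfl
      · exact Or.inr ⟨k, by simpa using h, rfl⟩

theorem exists_remove_of_mem {lam : YoungDiagram} {i : ℕ} (hi : i ∈ lam.removableRows) :
    ∃ mu : YoungDiagram, ∀ k, lam.rowLen k = mu.rowLen k + if k = i then 1 else 0 := by
  rw [mem_removableRows] at hi
  have hr : Antitone fun k => lam.rowLen k - if k = i then 1 else 0 := by
    refine antitone_nat_of_succ_le fun k => ?_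
    have := lam.rowLen_anti k (k + 1) (Nat.le_succ k)
    by_cases hk : k = i
    · subst hk
      simp only [Nat.succ_ne_self, if_false, if_true]
      omega
    · simp only [hk, if_false]
      omega
  refine ⟨ofAntitone _ hr (lam.colLen 0), fun k => ?_⟩
  rw [rowLen_ofAntitone hr (by simp [rowLen_colLen_zero])]
  split_ifs with hk
  · subst hk
    omega
  · rfl

theorem exists_add_of_mem {mu : YoungDiagram} {i : ℕ} (hi : i ∈ mu.addableRows) :
    ∃ lam : YoungDiagram, ∀ k, lam.rowLen k = mu.rowLen k + if k = i then 1 else 0 := by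
  rw [mem_addableRows] at hi
  have hr : Antitone fun k => mu.rowLen k + if k = i then 1 else 0 := by
    refine antitone_nat_of_succ_le fun k => ?_
    have := mu.rowLen_anti k (k + 1) (Nat.le_succ k)
    by_cases hk : k + 1 = i
    · subst hk
      simp only [if_true, Nat.succ_ne_zero, Nat.add_sub_cancel, false_or] at hi ⊢
      simp only [left_eq_add, one_ne_zero, if_false]
      omega
    · simp only [hk, if_false]
      omega
  refine ⟨ofAntitone _ hr (mu.colLen 0 + i + 1), fun k => ?_⟩
  rw [rowLen_ofAntitone hr]
  rw [rowLen_eq_zero_of_le mu.rowLen_colLen_zero (by omega), if_neg (by omega)]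

/-- The diagram without the last square of the row `i`. -/
def removeBox (lam : YoungDiagram) (i : ℕ) : YoungDiagram :=
  if h : i ∈ lam.removableRows then (exists_remove_of_mem h).choose else ⊥

theorem rowLen_removeBox {lam : YoungDiagram} {i : ℕ} (hi : i ∈ lam.removableRows) (k : ℕ) :
    lam.rowLen k = (lam.removeBox i).rowLen k + if k = i then 1 else 0 := by
  rw [removeBox, dif_pos hi]
  exact (exists_remove_of_mem hi).choose_spec k

/-- The diagram with a square added to the row `i`. -/
def addBox (mu : YoungDiagram) (i : ℕ) : YoungDiagram :=
  if h : i ∈ mu.addableRows then (exists_add_of_mem h).choose else ⊥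

theorem rowLen_addBox {mu : YoungDiagram} {i : ℕ} (hi : i ∈ mu.addableRows) (k : ℕ) :
    (mu.addBox i).rowLen k = mu.rowLen k + if k = i then 1 else 0 := by
  rw [addBox, dif_pos hi]
  exact (exists_add_of_mem hi).choose_spec k

theorem removeBox_injOn (lam : YoungDiagram) :
    Set.InjOn lam.removeBox lam.removableRows := by
  intro i hi j hj h
  have h1 := rowLen_removeBox hi i
  have h2 := rowLen_removeBox hj i
  rw [← h] at h2
  by_contra hij
  simp only [if_true, hij, if_false] at h1 h2
  omega

theorem addBox_injOn (mu : YoungDiagram) : Set.InjOn mu.addBox mu.addableRows := by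
  intro i hi j hj h
  have h1 := rowLen_addBox hi i
  have h2 := rowLen_addBox hj i
  rw [← h] at h2
  by_contra hij
  simp only [if_true, hij, if_false] at h1 h2
  omega

open Classical in
/-- The diagrams obtained by removing one square. -/
def down (lam : YoungDiagram) : Finset YoungDiagram := lam.removableRows.image lam.removeBox

open Classical in
/-- The diagrams obtained by adding one square. -/
def up (mu : YoungDiagram) : Finset YoungDiagram := mu.addableRows.image mu.addBox

theorem mem_down {mu lam : YoungDiagram} : mu ∈ lam.down ↔ IsBoxAdd mu lam := by
  classical
  rw [down, mem_image, isBoxAdd_iff]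
  constructor
  · rintro ⟨i, hi, rfl⟩
    exact ⟨i, rowLen_removeBox hi⟩
  · rintro ⟨i, hi⟩
    have hm : i ∈ lam.removableRows := by
      rw [mem_removableRows, hi i, hi (i + 1)]
      have := mu.rowLen_anti i (i + 1) (Nat.le_succ i)
      simp only [if_true, Nat.succ_ne_self, if_false]
      omega
    refine ⟨i, hm, ext_rowLen fun k => ?_⟩
    have h1 := rowLen_removeBox hm k
    have h2 := hi k
    omega

theorem mem_up {mu lam : YoungDiagram} : lam ∈ mu.up ↔ IsBoxAdd mu lam := by
  classical
  rw [up, mem_image, isBoxAdd_iff]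
  constructor
  · rintro ⟨i, hi, rfl⟩
    exact ⟨i, rowLen_addBox hi⟩
  · rintro ⟨i, hi⟩
    have hm : i ∈ mu.addableRows := by
      rw [mem_addableRows]
      by_cases h0 : i = 0
      · exact Or.inl h0
      · right
        have h1 := hi i
        have h2 := hi (i - 1)
        have := lam.rowLen_anti (i - 1) i (Nat.sub_le _ _)
        rw [if_pos rfl] at h1
        rw [if_neg (by omega)] at h2
        omega
    exact ⟨i, hm, ext_rowLen fun k => by rw [rowLen_addBox hm, hi]⟩

theorem card_up (lam : YoungDiagram) : #lam.up = #lam.down + 1 := by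
  classical
  rw [up, down, card_image_of_injOn lam.addBox_injOn, card_image_of_injOn lam.removeBox_injOn,
    card_addableRows]

/-- Two distinct diagrams one square below `mu` must have union `mu`; counting squares in union and
intersection then determines the size of the intersection. -/
theorem IsBoxAdd.sup_inf {lam nu mu : YoungDiagram} (h1 : IsBoxAdd lam mu) (h2 : IsBoxAdd nu mu)
    (hne : nu ≠ lam) :
    lam ⊔ nu = mu ∧ IsBoxAdd (lam ⊓ nu) lam ∧ IsBoxAdd (lam ⊓ nu) nu := by
  have hle : lam ⊔ nu ≤ mu := sup_le h1.1 h2.1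
  have hc1 := h1.2
  have hc2 := h2.2
  have hs : lam ⊔ nu = mu := by
    refine eq_of_le_of_card_le hle ?_
    by_contra! hlt
    have h3 := eq_of_le_of_card_le (le_sup_left : lam ≤ lam ⊔ nu) (by omega)
    have h4 : nu ≤ lam := h3 ▸ le_sup_right
    exact hne (eq_of_le_of_card_le h4 (by omega))
  have hc := card_sup_add_card_inf lam nu
  rw [hs] at hc
  exact ⟨hs, ⟨inf_le_left, by omega⟩, ⟨inf_le_right, by omega⟩⟩

theorem IsBoxAdd.inf_sup {lam nu ka : YoungDiagram} (h1 : IsBoxAdd ka lam) (h2 : IsBoxAdd ka nu)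
    (hne : nu ≠ lam) :
    lam ⊓ nu = ka ∧ IsBoxAdd lam (lam ⊔ nu) ∧ IsBoxAdd nu (lam ⊔ nu) := by
  have hle : ka ≤ lam ⊓ nu := le_inf h1.1 h2.1
  have hc1 := h1.2
  have hc2 := h2.2
  have hs : ka = lam ⊓ nu := by
    refine eq_of_le_of_card_le hle ?_
    by_contra! hlt
    have h3 := eq_of_le_of_card_le (inf_le_left : lam ⊓ nu ≤ lam) (by omega)
    have h4 : lam ≤ nu := h3 ▸ inf_le_right
    exact hne (eq_of_le_of_card_le h4 (by omega)).symm
  have hc := card_sup_add_card_inf lam nu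
  rw [← hs] at hc
  exact ⟨hs.symm, ⟨le_sup_left, by omega⟩, ⟨le_sup_right, by omega⟩⟩

/-- Decreasing chains of diagrams from `lam` to `⊥` of length `n`. -/
def IsRemovalChain (n : ℕ) (lam : YoungDiagram) (c : Fin (n + 1) → YoungDiagram) : Prop :=
  c 0 = lam ∧ c (Fin.last n) = ⊥ ∧
    ∀ i : Fin n, c i.succ ≤ c i.castSucc ∧ (c i.castSucc).card = (c i.succ).card + 1

/-- A chain consists of its first step and the remaining chain. -/
def removalChainEquiv (n : ℕ) (lam : YoungDiagram) :
    {c // IsRemovalChain (n + 1) lam c} ≃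
      Σ mu : {mu // mu ∈ lam.down}, {c // IsRemovalChain n mu.1 c} where
  toFun c := ⟨⟨c.1 1, mem_down.2 (by
      have h := c.2.2.2 0
      have h0 := c.2.1
      simp only [Fin.castSucc_zero, Fin.succ_zero_eq_one] at h
      rwa [h0] at h)⟩, ⟨Fin.tail c.1, rfl, c.2.2.1, fun i => c.2.2.2 i.succ⟩⟩
  invFun p := ⟨Fin.cons lam p.2.1, rfl, by
      rw [← Fin.succ_last, Fin.cons_succ]
      exact p.2.2.2.1, by
      intro i
      refine Fin.cases ?_ (fun i => ?_) i
      · rw [Fin.castSucc_zero, Fin.cons_zero, Fin.cons_succ, p.2.2.1]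
        exact mem_down.1 p.1.2
      · rw [Fin.castSucc_succ, Fin.cons_succ, Fin.cons_succ]
        exact p.2.2.2.2 i⟩
  left_inv c := by
    apply Subtype.ext
    have h0 : c.1 0 = lam := c.2.1
    simp only [← h0, Fin.cons_self_tail]
  right_inv := by
    rintro ⟨⟨mu, hmu⟩, ⟨c, hc⟩⟩
    obtain rfl : c 0 = mu := hc.1
    rfl

/-- Finiteness is what makes `Nat.card` additive over the first step of the chain. -/
instance finite_removalChain (n : ℕ) (lam : YoungDiagram) :
    Finite {c // IsRemovalChain n lam c} := by
  induction n generalizing lam with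
  | zero =>
    have : Subsingleton {c // IsRemovalChain 0 lam c} := by
      refine ⟨fun c d => Subtype.ext (funext fun i => ?_)⟩
      obtain rfl : i = 0 := Fin.fin_one_eq_zero i
      exact c.2.1.trans d.2.1.symm
    infer_instance
  | succ n ih => exact Finite.of_equiv _ (removalChainEquiv n lam).symm

end YoungDiagram

/-! ### Dimensions and the sum of their squares -/

open YoungDiagram Finset

theorem dimDiagram_eq_sum_down {lam : YoungDiagram} (h : lam.card ≠ 0) :
    dimDiagram lam = ∑ mu ∈ lam.down, dimDiagram mu := by
  obtain ⟨n, hn⟩ := Nat.exists_eq_succ_of_ne_zero h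
  have h1 : dimDiagram lam = Nat.card {c // IsRemovalChain lam.card lam c} := rfl
  rw [h1, hn, Nat.card_congr (removalChainEquiv n lam), Nat.card_sigma,
    Finset.univ_eq_attach, Finset.sum_attach lam.down
      (fun mu => Nat.card {c // IsRemovalChain n mu c})]
  refine Finset.sum_congr rfl fun mu hmu => ?_
  have hc := (mem_down.1 hmu).2
  have : n = mu.card := by omega
  rw [this]
  rfl

theorem dimDiagram_bot : dimDiagram ⊥ = 1 := by
  have h1 : dimDiagram ⊥ = Nat.card {c // IsRemovalChain 0 ⊥ c} := rfl
  rw [h1, Nat.card_eq_one_iff_unique]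
  refine ⟨⟨fun c d => Subtype.ext (funext fun i => ?_)⟩, ⟨fun _ => ⊥, rfl, rfl, fun i => i.elim0⟩⟩
  obtain rfl : i = 0 := Fin.fin_one_eq_zero i
  exact c.2.1.trans d.2.1.symm

/-- Going up then down and going down then up reach each diagram other than `lam` equally often,
while the returns to `lam` differ by one. With the branching rule, induction on the size gives the
factor |λ| + 1. -/
theorem sum_up_dimDiagram (lam : YoungDiagram) :
    ∑ mu ∈ lam.up, dimDiagram mu = (lam.card + 1) * dimDiagram lam := by
  classical
  obtain ⟨n, hn⟩ : ∃ n, lam.card = n := ⟨_, rfl⟩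
  induction n using Nat.strong_induction_on generalizing lam with
  | _ n ih =>
  have hup : ∑ mu ∈ lam.up, dimDiagram mu = #lam.up * dimDiagram lam +
      ∑ mu ∈ lam.up, ∑ nu ∈ mu.down.erase lam, dimDiagram nu := by
    rw [← smul_eq_mul, ← Finset.sum_const, ← Finset.sum_add_distrib]
    refine Finset.sum_congr rfl fun mu hmu => ?_
    have h1 := mem_up.1 hmu
    have := h1.2
    rw [Finset.add_sum_erase _ _ (mem_down.2 h1), dimDiagram_eq_sum_down (by omega)]
  have hdown : ∑ ka ∈ lam.down, ∑ nu ∈ ka.up, dimDiagram nu = #lam.down * dimDiagram lam +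
      ∑ ka ∈ lam.down, ∑ nu ∈ ka.up.erase lam, dimDiagram nu := by
    rw [← smul_eq_mul, ← Finset.sum_const, ← Finset.sum_add_distrib]
    refine Finset.sum_congr rfl fun ka hka => ?_
    rw [Finset.add_sum_erase _ _ (mem_up.2 (mem_down.1 hka))]
  -- For `nu` different from `lam`, the upper neighbour is the union and the lower neighbour is the
  -- intersection, so each determines the other.
  have hswap : ∑ mu ∈ lam.up, ∑ nu ∈ mu.down.erase lam, dimDiagram nu =
      ∑ ka ∈ lam.down, ∑ nu ∈ ka.up.erase lam, dimDiagram nu := by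
    rw [Finset.sum_sigma', Finset.sum_sigma']
    refine Finset.sum_bij' (fun p _ => ⟨lam ⊓ p.2, p.2⟩) (fun p _ => ⟨lam ⊔ p.2, p.2⟩) ?_ ?_ ?_ ?_ ?_
    · rintro ⟨mu, nu⟩ h
      simp only [mem_sigma, mem_erase, mem_up, mem_down] at h ⊢
      obtain ⟨-, h2, h3⟩ := h.1.sup_inf h.2.2 h.2.1
      exact ⟨h2, h.2.1, h3⟩
    · rintro ⟨ka, nu⟩ h
      simp only [mem_sigma, mem_erase, mem_up, mem_down] at h ⊢
      obtain ⟨-, h2, h3⟩ := h.1.inf_sup h.2.2 h.2.1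
      exact ⟨h2, h.2.1, h3⟩
    · rintro ⟨mu, nu⟩ h
      simp only [mem_sigma, mem_erase, mem_up, mem_down] at h ⊢
      rw [(h.1.sup_inf h.2.2 h.2.1).1]
    · rintro ⟨ka, nu⟩ h
      simp only [mem_sigma, mem_erase, mem_up, mem_down] at h ⊢
      rw [(h.1.inf_sup h.2.2 h.2.1).1]
    · intros
      rfl
  have hrec : ∑ ka ∈ lam.down, ∑ nu ∈ ka.up, dimDiagram nu = lam.card * dimDiagram lam := by
    by_cases h0 : lam.card = 0
    · rw [h0, zero_mul]
      refine Finset.sum_eq_zero fun ka hka => ?_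
      have := (mem_down.1 hka).2
      omega
    · rw [dimDiagram_eq_sum_down h0, Finset.mul_sum]
      refine Finset.sum_congr rfl fun ka hka => ?_
      have := (mem_down.1 hka).2
      rw [ih ka.card (by omega) ka rfl, this]
  rw [hup, hswap, card_up]
  rw [hrec] at hdown
  linarith

theorem finite_setOf_card_eq (n : ℕ) : {lam : YoungDiagram | lam.card = n}.Finite := by
  refine Set.Finite.of_finite_image (f := YoungDiagram.cells)
    ((range n ×ˢ range n).powerset.finite_toSet.subset ?_)
    (fun _ _ _ _ h => YoungDiagram.ext h)
  rintro _ ⟨lam, hlam, rfl⟩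
  simp only [coe_powerset, Set.mem_preimage, Set.mem_powerset_iff, Finset.coe_subset]
  rintro ⟨i, j⟩ hij
  -- A cell (i, j) forces a full (i+1) × (j+1) rectangle, so both coordinates are less than `n`.
  have hsub : range (i + 1) ×ˢ range (j + 1) ⊆ lam.cells := by
    rintro ⟨a, b⟩ hab
    simp only [mem_product, mem_range] at hab
    exact lam.up_left_mem (by omega) (by omega) hij
  have hcard := Finset.card_le_card hsub
  have hlam' : lam.cells.card = n := hlam
  rw [card_product, card_range, card_range, hlam'] at hcard
  simp only [mem_product, mem_range]
  constructor <;> nlinarith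

/-- One factor of each square is expanded by the branching rule; regrouping the sum over edges by
the smaller diagram and applying `sum_up_dimDiagram` gives the recurrence of the factorial. -/
theorem sum_dimDiagram_sq (n : ℕ) :
    ∑ lam ∈ (finite_setOf_card_eq n).toFinset, dimDiagram lam ^ 2 = n ! := by
  induction n with
  | zero =>
    have : (finite_setOf_card_eq 0).toFinset = {⊥} := by
      ext lam
      simp only [Set.Finite.mem_toFinset, Set.mem_ofPred_eq, mem_singleton]
      exact ⟨eq_bot_of_card_eq_zero, by rintro rfl; rfl⟩
    rw [this, sum_singleton, dimDiagram_bot]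
    rfl
  | succ n ih =>
    have h1 : ∀ lam ∈ (finite_setOf_card_eq (n + 1)).toFinset, dimDiagram lam ^ 2 =
        ∑ mu ∈ lam.down, dimDiagram lam * dimDiagram mu := by
      intro lam hlam
      have hc : lam.card = n + 1 := by simpa using hlam
      rw [← Finset.mul_sum, ← dimDiagram_eq_sum_down (by omega), sq]
    rw [Finset.sum_congr rfl h1, Finset.sum_comm' (t' := (finite_setOf_card_eq n).toFinset)
      (s' := fun mu => mu.up)]
    · have h2 : ∀ mu ∈ (finite_setOf_card_eq n).toFinset,
          ∑ lam ∈ mu.up, dimDiagram lam * dimDiagram mu = (n + 1) * dimDiagram mu ^ 2 := by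
        intro mu hmu
        have hc : mu.card = n := by simpa using hmu
        rw [← Finset.sum_mul, sum_up_dimDiagram, hc]
        ring
      rw [Finset.sum_congr rfl h2, ← Finset.mul_sum, ih, Nat.factorial_succ]
    · intro lam mu
      simp only [Set.Finite.mem_toFinset, Set.mem_ofPred_eq, mem_up, mem_down]
      constructor
      · rintro ⟨h1, h2⟩
        exact ⟨h2, by have := h2.2; omega⟩
      · rintro ⟨h1, h2⟩
        exact ⟨by have := h1.2; omega, h1⟩

/-! ### The Poissonized measure -/

theorem poissonPlancherelWeight_nonneg {ξ : ℝ} (hξ : 0 ≤ ξ) (lam : YoungDiagram) :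
    0 ≤ poissonPlancherelWeight ξ lam := by
  unfold poissonPlancherelWeight
  positivity

/-- The diagrams of size n have total weight e^(-ξ) ξ^n / n!, the Poisson law. -/
theorem hasSum_poissonPlancherelWeight {ξ : ℝ} (hξ : 0 ≤ ξ) :
    HasSum (poissonPlancherelWeight ξ) 1 := by
  let e := Equiv.sigmaFiberEquiv (fun lam : YoungDiagram => lam.card)
  have hfib : ∀ n, HasSum (fun c : {lam : YoungDiagram // lam.card = n} =>
      poissonPlancherelWeight ξ (e ⟨n, c⟩)) (Real.exp (-ξ) * (ξ ^ n / n !)) := by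
    intro n
    have hs : ∑ lam ∈ (finite_setOf_card_eq n).toFinset, poissonPlancherelWeight ξ lam =
        Real.exp (-ξ) * (ξ ^ n / n !) := by
      have h1 : ∀ lam ∈ (finite_setOf_card_eq n).toFinset, poissonPlancherelWeight ξ lam =
          Real.exp (-ξ) * ξ ^ n / (n ! : ℝ) ^ 2 * ((dimDiagram lam ^ 2 : ℕ) : ℝ) := by
        intro lam hlam
        have hc : lam.card = n := by simpa using hlam
        rw [poissonPlancherelWeight, hc]
        push_cast
        ring
      have hn : (n ! : ℝ) ≠ 0 := by positivity
      rw [Finset.sum_congr rfl h1, ← Finset.mul_sum, ← Nat.cast_sum, sum_dimDiagram_sq]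
      field_simp
    have := Finset.hasSum (finite_setOf_card_eq n).toFinset (poissonPlancherelWeight ξ)
    rw [hs] at this
    have h2 : HasSum (poissonPlancherelWeight ξ ∘
        ((↑) : ({lam : YoungDiagram | lam.card = n}) → YoungDiagram))
        (Real.exp (-ξ) * (ξ ^ n / n !)) := by
      have hset : ((finite_setOf_card_eq n).toFinset : Set YoungDiagram) =
        {lam : YoungDiagram | lam.card = n} := by simp
      rw [← hset]
      exact this
    exact h2
  have hexp : HasSum (fun n : ℕ => Real.exp (-ξ) * (ξ ^ n / n !)) 1 := by
    have := (NormedSpace.expSeries_div_hasSum_exp ξ).mul_left (Real.exp (-ξ))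
    rwa [← Real.exp_eq_exp_ℝ, ← Real.exp_add, neg_add_cancel, Real.exp_zero] at this
  rw [← e.hasSum_iff]
  refine HasSum.sigma_of_hasSum hexp hfib ?_
  refine (summable_sigma_of_nonneg fun _ => poissonPlancherelWeight_nonneg hξ _).2
    ⟨fun n => (hfib n).summable, ?_⟩
  refine hexp.summable.congr fun n => ?_
  exact (hfib n).tsum_eq.symm

theorem isProbabilityMeasure_poissonPlancherel {ξ : ℝ} (hξ : 0 ≤ ξ) :
    IsProbabilityMeasure (poissonPlancherel ξ) := by
  refine ⟨?_⟩
  rw [poissonPlancherel, Measure.sum_apply _ MeasurableSet.univ]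
  simp only [Measure.smul_apply, measure_univ, smul_eq_mul, mul_one]
  rw [← ENNReal.ofReal_tsum_of_nonneg (poissonPlancherelWeight_nonneg hξ)
    (hasSum_poissonPlancherelWeight hξ).summable, (hasSum_poissonPlancherelWeight hξ).tsum_eq,
    ENNReal.ofReal_one]

open Classical in
theorem poissonPlancherel_real_apply {ξ : ℝ} (hξ : 0 ≤ ξ) (S : Set YoungDiagram) :
    (poissonPlancherel ξ).real S =
      ∑' lam, if lam ∈ S then poissonPlancherelWeight ξ lam else 0 := by
  have hnn : ∀ lam, 0 ≤ if lam ∈ S then poissonPlancherelWeight ξ lam else 0 := by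
    intro lam
    split_ifs
    exacts [poissonPlancherelWeight_nonneg hξ lam, le_rfl]
  rw [Measure.real, poissonPlancherel, Measure.sum_apply _ MeasurableSpace.measurableSet_top]
  have h : ∀ lam, (ENNReal.ofReal (poissonPlancherelWeight ξ lam) • Measure.dirac lam) S =
      ENNReal.ofReal (if lam ∈ S then poissonPlancherelWeight ξ lam else 0) := by
    intro lam
    rw [Measure.smul_apply, Measure.dirac_apply' _ MeasurableSpace.measurableSet_top, smul_eq_mul]
    by_cases h : lam ∈ S <;> simp [h]
  simp only [h]
  rw [← ENNReal.ofReal_tsum_of_nonneg hnn, ENNReal.toReal_ofReal (tsum_nonneg hnn)]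
  refine Summable.of_nonneg_of_le hnn (fun lam => ?_) (hasSum_poissonPlancherelWeight hξ).summable
  split_ifs
  exacts [le_rfl, poissonPlancherelWeight_nonneg hξ lam]

/-! ### The determinantal formula for dimensions -/

/-- The coefficient `t ^ m / m!` of the exponential series, zero for negative `m`. -/
def expCoeff (t : ℂ) (m : ℤ) : ℂ := if 0 ≤ m then t ^ m.toNat / (m.toNat ! : ℂ) else 0

theorem expCoeff_natCast (t : ℂ) (m : ℕ) : expCoeff t m = t ^ m / (m ! : ℂ) := by
  simp [expCoeff]

theorem expCoeff_zero (t : ℂ) : expCoeff t 0 = 1 := by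
  simp [expCoeff]

theorem expCoeff_of_neg (t : ℂ) {m : ℤ} (hm : m < 0) : expCoeff t m = 0 := by
  rw [expCoeff, if_neg (by omega)]

theorem mul_expCoeff (t : ℂ) (m : ℤ) : t * expCoeff t (m - 1) = m * expCoeff t m := by
  rcases lt_trichotomy m 0 with h | rfl | h
  · rw [expCoeff_of_neg t h, expCoeff_of_neg t (by omega), mul_zero, mul_zero]
  · rw [expCoeff_of_neg t (by omega)]
    simp
  · obtain ⟨k, rfl⟩ : ∃ k : ℕ, m = (k + 1 : ℕ) := ⟨(m - 1).toNat, by omega⟩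
    have : (((k + 1 : ℕ) : ℤ) - 1) = (k : ℕ) := by push_cast; ring
    rw [this, expCoeff_natCast, expCoeff_natCast, Nat.factorial_succ]
    have h1 : (k ! : ℂ) ≠ 0 := by exact_mod_cast Nat.factorial_ne_zero k
    have h2 : ((k : ℂ) + 1) ≠ 0 := by exact_mod_cast Nat.succ_ne_zero k
    push_cast
    field_simp
    ring

/-- The sum over the rows of the determinants in which the entries of one row are multiplied by
`a i + b j`. -/
theorem sum_det_updateRow_add_mul {ι R : Type*} [Fintype ι] [DecidableEq ι] [CommRing R]
    (M : Matrix ι ι R) (a b : ι → R) :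
    ∑ i, (M.updateRow i fun j => (a i + b j) * M i j).det = (∑ i, a i + ∑ j, b j) * M.det := by
  -- In the Leibniz expansion the update multiplies the term of σ by a_i + b_{σ(i)}; summed over i,
  -- this factor no longer depends on σ.
  have h1 : ∀ i, (M.updateRow i fun j => (a i + b j) * M i j).det =
      ∑ σ : Equiv.Perm ι, (a i + b (σ i)) * ((Equiv.Perm.sign σ : ℤ) * ∏ k, M k (σ k)) := by
    intro i
    rw [← Matrix.det_transpose, Matrix.det_apply']
    refine Finset.sum_congr rfl fun σ _ => ?_
    have : ∀ k, (M.updateRow i fun j => (a i + b j) * M i j).transpose (σ k) k =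
        (if k = i then a i + b (σ i) else 1) * M k (σ k) := by
      intro k
      rw [Matrix.transpose_apply]
      split_ifs with h
      · subst h
        rw [Matrix.updateRow_self]
      · rw [Matrix.updateRow_ne h, one_mul]
    simp only [this, Finset.prod_mul_distrib, Finset.prod_ite_eq', Finset.mem_univ, if_true]
    ring
  simp only [h1]
  rw [Finset.sum_comm, ← Matrix.det_transpose M, Matrix.det_apply', Finset.mul_sum]
  refine Finset.sum_congr rfl fun σ _ => ?_
  rw [← Finset.sum_mul, Finset.sum_add_distrib, Equiv.sum_comp σ b]
  rfl

/-- The shifted row lengths `lam_i - i`, rows being numbered from `0`. -/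
def shiftedRow (lam : YoungDiagram) (i : ℕ) : ℤ := lam.rowLen i - i

theorem shiftedRow_strictAnti (lam : YoungDiagram) : StrictAnti (shiftedRow lam) := by
  intro i j hij
  have := lam.rowLen_anti i j hij.le
  unfold shiftedRow
  omega

/-- The determinant `det [t ^ (lam_i - i + j) / (lam_i - i + j)!]`. -/
def jacobiTrudiDet (t : ℂ) (N : ℕ) (lam : YoungDiagram) : ℂ :=
  Matrix.det (Matrix.of fun i j : Fin N => expCoeff t (shiftedRow lam i + j))

theorem jacobiTrudiDet_bot (t : ℂ) (N : ℕ) : jacobiTrudiDet t N ⊥ = 1 := by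
  rw [jacobiTrudiDet, Matrix.det_of_isUpperTriangular]
  · simp [shiftedRow, rowLen_bot, expCoeff_zero]
  · intro i j hij
    have hij' : j < i := hij
    rw [Matrix.of_apply, expCoeff_of_neg]
    rw [shiftedRow, rowLen_bot]
    have : (j : ℕ) < i := hij'
    omega

/-- Replacing λ_i by λ_i - 1 and multiplying by t multiplies the entries of row i by λ_i - i + j, by
`mul_expCoeff`. Summed over the rows, these factors give ∑(λ_i - i) + ∑ j = |λ|. -/
theorem mul_sum_down_jacobiTrudiDet (t : ℂ) {N : ℕ} {lam : YoungDiagram}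
    (hN : lam.rowLen N = 0) :
    t * ∑ mu ∈ lam.down, jacobiTrudiDet t N mu = lam.card * jacobiTrudiDet t N lam := by
  classical
  set M : Matrix (Fin N) (Fin N) ℂ := Matrix.of fun i j => expCoeff t (shiftedRow lam i + j)
    with hM
  let v : Fin N → Fin N → ℂ := fun i j => expCoeff t (shiftedRow lam i - 1 + j)
  have h1 : ∀ i : Fin N, t * (M.updateRow i (v i)).det =
      (M.updateRow i fun j => ((shiftedRow lam i : ℂ) + (j : ℕ)) * M i j).det := by
    intro i
    have : (fun j : Fin N => ((shiftedRow lam i : ℂ) + (j : ℕ)) * M i j) = t • v i := by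
      funext j
      rw [Pi.smul_apply, smul_eq_mul, hM, Matrix.of_apply]
      have := mul_expCoeff t (shiftedRow lam i + j)
      rw [show shiftedRow lam i + j - 1 = shiftedRow lam i - 1 + j by ring] at this
      rw [this]
      push_cast
      ring
    rw [this, Matrix.det_updateRow_smul]
  have h2 : t * ∑ i, (M.updateRow i (v i)).det = lam.card * M.det := by
    rw [Finset.mul_sum, Finset.sum_congr rfl fun i _ => h1 i,
      sum_det_updateRow_add_mul M (fun i => (shiftedRow lam i : ℂ)) (fun j => ((j : ℕ) : ℂ)),
      ← Finset.sum_add_distrib, card_eq_sum_rowLen hN, ← Fin.sum_univ_eq_sum_range]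
    congr 1
    push_cast
    refine Finset.sum_congr rfl fun i _ => ?_
    simp [shiftedRow]
  rw [jacobiTrudiDet, ← hM, ← h2]
  congr 1
  -- If λ_i = λ_{i+1}, lowering row i makes it equal to the next one. In the last row, λ_i = 0 and
  -- the lowered row has only negative indices, hence vanishes.
  have h3 : ∀ i : Fin N, (i : ℕ) ∉ lam.removableRows → (M.updateRow i (v i)).det = 0 := by
    intro i hi
    rw [mem_removableRows, not_lt] at hi
    by_cases hiN : (i : ℕ) + 1 < N
    · refine Matrix.det_zero_of_row_eq (i := i) (j := ⟨i + 1, hiN⟩)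
        (by intro h; simpa using congrArg Fin.val h) ?_
      rw [Matrix.updateRow_self, Matrix.updateRow_ne (by intro h; simpa using congrArg Fin.val h)]
      funext j
      have := lam.rowLen_anti i (i + 1) (Nat.le_succ i)
      have he : lam.rowLen (i + 1) = lam.rowLen i := le_antisymm this hi
      simp only [v, hM, Matrix.of_apply, shiftedRow, he]
      congr 1
      push_cast
      ring
    · have hiN' : (i : ℕ) + 1 = N := by omega
      have h0 : lam.rowLen i = 0 := by
        rw [hiN', hN] at hi
        omega
      refine Matrix.det_eq_zero_of_row_eq_zero i fun j => ?_
      rw [Matrix.updateRow_self]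
      apply expCoeff_of_neg
      rw [shiftedRow, h0]
      have := j.2
      omega
  have h4 : ∀ i : Fin N, (i : ℕ) ∈ lam.removableRows →
      (M.updateRow i (v i)).det = jacobiTrudiDet t N (lam.removeBox i) := by
    intro i hi
    rw [jacobiTrudiDet]
    congr 1
    ext k j
    have hk := rowLen_removeBox hi k
    by_cases hki : k = i
    · subst hki
      rw [Matrix.updateRow_self, Matrix.of_apply]
      simp only [v, shiftedRow]
      rw [if_pos rfl] at hk
      congr 1
      omega
    · have : (k : ℕ) ≠ i := fun h => hki (Fin.ext h)
      rw [Matrix.updateRow_ne hki, hM, Matrix.of_apply, Matrix.of_apply]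
      simp only [shiftedRow]
      rw [if_neg this] at hk
      congr 1
      omega
  have hsub : lam.removableRows ⊆ range N := by
    intro i hi
    rw [mem_removableRows] at hi
    rw [mem_range]
    by_contra! hle
    rw [rowLen_eq_zero_of_le hN hle] at hi
    omega
  rw [down, Finset.sum_image lam.removeBox_injOn]
  let F : ℕ → ℂ := fun i => if i ∈ lam.removableRows then jacobiTrudiDet t N (lam.removeBox i) else 0
  have h5 : ∀ i : Fin N, (M.updateRow i (v i)).det = F i := by
    intro i
    simp only [F]
    split_ifs with h
    exacts [h4 i h, h3 i h]
  rw [Finset.sum_congr rfl fun i _ => h5 i, Fin.sum_univ_eq_sum_range]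
  rw [← Finset.sum_subset hsub fun i _ hi => if_neg hi]
  exact Finset.sum_congr rfl fun i hi => (if_pos hi).symm

/-- The determinantal formula for the number of standard tableaux. -/
theorem jacobiTrudiDet_eq (t : ℂ) {N : ℕ} {lam : YoungDiagram} (hN : lam.rowLen N = 0) :
    jacobiTrudiDet t N lam = t ^ lam.card * ((dimDiagram lam : ℂ) / (lam.card ! : ℂ)) := by
  -- By induction on the size: both sides satisfy the same recurrence over `lam.down`.
  obtain ⟨n, hn⟩ : ∃ n, lam.card = n := ⟨_, rfl⟩
  induction n generalizing lam with
  | zero =>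
    rw [eq_bot_of_card_eq_zero hn, jacobiTrudiDet_bot, dimDiagram_bot]
    simp [YoungDiagram.card]
  | succ n ih =>
    have hrec := mul_sum_down_jacobiTrudiDet t hN
    have h1 : ∀ mu ∈ lam.down, jacobiTrudiDet t N mu =
        t ^ n * ((dimDiagram mu : ℂ) / (n ! : ℂ)) := by
      intro mu hmu
      have hadd := mem_down.1 hmu
      have hc : mu.card = n := by
        have := hadd.2
        omega
      have hle := le_iff_rowLen_le.1 hadd.1 N
      rw [ih (by omega) hc, hc]
    rw [Finset.sum_congr rfl h1, ← Finset.mul_sum, ← Finset.sum_div, ← Nat.cast_sum,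
      ← dimDiagram_eq_sum_down (by omega), hn] at hrec
    have h2 : (n ! : ℂ) ≠ 0 := by exact_mod_cast Nat.factorial_ne_zero n
    have h3 : ((n + 1 : ℕ) : ℂ) ≠ 0 := by exact_mod_cast Nat.succ_ne_zero n
    rw [hn]
    apply mul_left_cancel₀ h3
    rw [← hrec, Nat.factorial_succ]
    push_cast at h3 ⊢
    field_simp
    ring

/-- A strictly decreasing tuple with a nonvanishing minor comes from a diagram. -/
theorem exists_shiftedRow_of_det_ne_zero {t : ℂ} {N : ℕ} {g : Fin N → ℤ} (hg : StrictAnti g)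
    (hdet : Matrix.det (Matrix.of fun i j : Fin N => expCoeff t (g i + j)) ≠ 0) :
    ∃ lam : YoungDiagram, lam.rowLen N = 0 ∧ ∀ i : Fin N, shiftedRow lam i = g i := by
  -- For strictly decreasing integers, the future row lengths g_i + i are weakly decreasing.
  have hstep : ∀ i j : Fin N, i ≤ j → g j + j ≤ g i + i := by
    intro i j hij
    obtain ⟨d, hd⟩ : ∃ d : ℕ, (j : ℕ) = i + d := Nat.exists_eq_add_of_le hij
    induction d generalizing j with
    | zero =>
      have : j = i := Fin.ext (by omega)
      rw [this]
    | succ d ih =>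
      have hd' : (i : ℕ) + d < N := by omega
      have h1 := ih ⟨i + d, hd'⟩ (Fin.le_def.2 (by simp)) rfl
      have h2 := hg (show (⟨i + d, hd'⟩ : Fin N) < j from Fin.lt_def.2 (by simp; omega))
      simp only at h1
      push_cast at h1
      rw [hd]
      push_cast
      omega
  have hnn : ∀ i : Fin N, 0 ≤ g i + i := by
    intro i
    have hN : 0 < N := i.pos
    let l : Fin N := ⟨N - 1, by omega⟩
    -- The last index has the largest column shift, so a negative last row length would make the
    -- whole last row of the matrix vanish.
    have hl : 0 ≤ g l + l := by
      by_contra! hneg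
      apply hdet
      refine Matrix.det_eq_zero_of_row_eq_zero l fun j => ?_
      rw [Matrix.of_apply]
      apply expCoeff_of_neg
      have h1 : (j : ℕ) ≤ l := by
        have := j.2
        simp only [l]
        omega
      omega
    refine hl.trans (hstep i l (Fin.le_def.2 ?_))
    have := i.2
    simp only [l]
    omega
  let r : ℕ → ℕ := fun i => if h : i < N then (g ⟨i, h⟩ + i).toNat else 0
  have hr : Antitone r := by
    intro i j hij
    simp only [r]
    by_cases hj : j < N
    · rw [dif_pos hj, dif_pos (lt_of_le_of_lt hij hj)]
      exact Int.toNat_le_toNat (hstep ⟨i, lt_of_le_of_lt hij hj⟩ ⟨j, hj⟩ (Fin.le_def.2 hij))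
    · rw [dif_neg hj]
      exact Nat.zero_le _
  have hrN : r N = 0 := dif_neg (lt_irrefl N)
  refine ⟨ofAntitone r hr N, by rw [rowLen_ofAntitone hr hrN, hrN], fun i => ?_⟩
  rw [shiftedRow, rowLen_ofAntitone hr hrN]
  have := hnn i
  have hri : r i = (g i + i).toNat := dif_pos i.2
  omega

theorem eq_of_shiftedRow_eq {N : ℕ} {lam mu : YoungDiagram} (h1 : lam.rowLen N = 0)
    (h2 : mu.rowLen N = 0) (h : ∀ i : Fin N, shiftedRow lam i = shiftedRow mu i) : lam = mu := by
  refine ext_rowLen fun i => ?_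
  by_cases hi : i < N
  · have := h ⟨i, hi⟩
    simp only [shiftedRow] at this
    omega
  · rw [rowLen_eq_zero_of_le h1 (by omega), rowLen_eq_zero_of_le h2 (by omega)]

/-! ### Bessel functions and contour integrals -/

section ContourIntegrals

open Filter Topology
open scoped ComplexConjugate

/-- Termwise integration over a circle. -/
theorem hasSum_circleIntegral {ι : Type*} [Countable ι] {F : ι → ℂ → ℂ} {f : ℂ → ℂ} {R : ℝ}
    (hR : 0 < R) (bound : ι → ℝ) (hc : ∀ k, ContinuousOn (F k) (Metric.sphere 0 R))
    (hb : ∀ k, ∀ z ∈ Metric.sphere (0 : ℂ) R, ‖F k z‖ ≤ bound k) (hbs : Summable bound)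
    (hs : ∀ z ∈ Metric.sphere (0 : ℂ) R, HasSum (fun k => F k z) (f z)) :
    HasSum (fun k => ∮ z in C(0, R), F k z) (∮ z in C(0, R), f z) := by
  have hmem : ∀ θ : ℝ, circleMap 0 R θ ∈ Metric.sphere (0 : ℂ) R :=
    fun θ => circleMap_mem_sphere 0 hR.le θ
  refine intervalIntegral.hasSum_integral_of_dominated_convergence
    (bound := fun k _ => R * bound k) (fun k => ?_) (fun k => ?_) ?_ ?_ ?_
  · refine Continuous.aestronglyMeasurable ?_
    simp only [deriv_circleMap, smul_eq_mul]
    exact ((continuous_circleMap 0 R).mul continuous_const).mul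
      ((hc k).comp_continuous (continuous_circleMap 0 R) hmem)
  · filter_upwards with θ _
    rw [norm_smul, deriv_circleMap, norm_mul, norm_circleMap_zero, Complex.norm_I, mul_one,
      abs_of_pos hR]
    exact mul_le_mul_of_nonneg_left (hb k _ (hmem θ)) hR.le
  · filter_upwards with θ _ using hbs.mul_left R
  · exact intervalIntegrable_const
  · filter_upwards with θ _ using (hs _ (hmem θ)).const_smul _

theorem ne_zero_of_mem_sphere_zero {R : ℝ} (hR : 0 < R) {z : ℂ} (hz : z ∈ Metric.sphere (0 : ℂ) R) :
    z ≠ 0 := by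
  rintro rfl
  rw [mem_sphere_zero_iff_norm, norm_zero] at hz
  exact hR.ne hz

theorem continuousOn_zpow_sphere {R : ℝ} (hR : 0 < R) (n : ℤ) :
    ContinuousOn (fun z : ℂ => z ^ n) (Metric.sphere (0 : ℂ) R) :=
  fun _ hz => (continuousAt_zpow₀ _ n (Or.inl (ne_zero_of_mem_sphere_zero hR hz))).continuousWithinAt

/-- The coefficients of a Laurent series as contour integrals. -/
theorem circleIntegral_mul_zpow_of_hasSum {a : ℤ → ℂ} {f : ℂ → ℂ} {R : ℝ} (hR : 0 < R)
    (h : ∀ z ∈ Metric.sphere (0 : ℂ) R, HasSum (fun n : ℤ => a n * z ^ n) (f z)) (n : ℤ) :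
    (∮ z in C(0, R), f z * z ^ (-n - 1)) = 2 * π * Complex.I * a n := by
  -- Absolute convergence at the single point z = R bounds the terms on the whole circle.
  have hsum : Summable fun m : ℤ => ‖a m‖ * R ^ m := by
    have h1 : (R : ℂ) ∈ Metric.sphere (0 : ℂ) R := by simp [hR.le]
    refine (h _ h1).summable.norm.congr fun m => ?_
    rw [norm_mul, norm_zpow, Complex.norm_real, Real.norm_of_nonneg hR.le]
  have hterm : ∀ m : ℤ, (∮ z in C(0, R), a m * z ^ m * z ^ (-n - 1)) =
      if m = n then 2 * π * Complex.I * a n else 0 := by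
    intro m
    have hc : (∮ z in C(0, R), a m * z ^ m * z ^ (-n - 1)) =
        ∮ z in C(0, R), a m * (z - 0) ^ (m - n - 1) := by
      refine circleIntegral.integral_congr hR.le fun z hz => ?_
      simp only [sub_zero, mul_assoc, ← zpow_add₀ (ne_zero_of_mem_sphere_zero hR hz)]
      congr 2
      ring
    rw [hc, circleIntegral.integral_const_mul]
    split_ifs with h
    · subst h
      simp only [sub_self, zero_sub, zpow_neg_one]
      rw [circleIntegral.integral_sub_center_inv 0 hR.ne']
      ring
    · rw [circleIntegral.integral_sub_zpow_of_ne (by omega), mul_zero]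
  have hI := hasSum_circleIntegral (F := fun m z => a m * z ^ m * z ^ (-n - 1)) hR
    (fun m => ‖a m‖ * R ^ m * R ^ (-n - 1))
    (fun m => (continuousOn_const.mul (continuousOn_zpow_sphere hR m)).mul
      (continuousOn_zpow_sphere hR _))
    (fun m z hz => by
      rw [mem_sphere_zero_iff_norm] at hz
      rw [norm_mul, norm_mul, norm_zpow, norm_zpow, hz])
    (hsum.mul_right _) (fun z hz => (h z hz).mul_right _)
  simp only [hterm] at hI
  exact hI.unique (hasSum_ite_eq n (2 * π * Complex.I * a n))

theorem circleIntegral_exp_mul_zpow {R : ℝ} (hR : 0 < R) (t : ℂ) (n : ℤ) :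
    (∮ z in C(0, R), Complex.exp (t / 2 * (z - z⁻¹)) * z ^ (-n - 1)) =
      2 * π * Complex.I * besselJ n t :=
  circleIntegral_mul_zpow_of_hasSum hR
    (fun z hz => hasSum_besselJ t z (ne_zero_of_mem_sphere_zero hR hz)) n

theorem eq_besselJ_of_hasSum {a : ℤ → ℂ} {t : ℂ}
    (h : ∀ z : ℂ, z ≠ 0 → HasSum (fun n : ℤ => a n * z ^ n) (Complex.exp (t / 2 * (z - z⁻¹))))
    (n : ℤ) : a n = besselJ n t := by
  have h1 := circleIntegral_mul_zpow_of_hasSum one_pos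
    (fun z hz => h z (ne_zero_of_mem_sphere_zero one_pos hz)) n
  rw [circleIntegral_exp_mul_zpow one_pos] at h1
  exact (mul_left_cancel₀ Complex.two_pi_I_ne_zero h1).symm

/-- The generating function is unchanged when z becomes z⁻¹ and t becomes -t. -/
theorem besselJ_neg_neg (n : ℤ) (t : ℂ) : besselJ (-n) (-t) = besselJ n t := by
  refine eq_besselJ_of_hasSum (a := fun n => besselJ (-n) (-t)) (fun z hz => ?_) n
  have h := hasSum_besselJ (-t) z⁻¹ (inv_ne_zero hz)
  rw [← (Equiv.neg ℤ).hasSum_iff] at h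
  rw [show t / 2 * (z - z⁻¹) = -t / 2 * (z⁻¹ - z⁻¹⁻¹) by rw [inv_inv]; ring]
  refine h.congr_fun fun m => ?_
  simp

theorem conj_besselJ (n : ℤ) (t : ℂ) : conj (besselJ n t) = besselJ n (conj t) := by
  refine eq_besselJ_of_hasSum (a := fun n => conj (besselJ n t)) (fun z hz => ?_) n
  have h := (hasSum_besselJ t (conj z) (by simpa using hz)).mapL
    (Complex.conjCLE : ℂ →L[ℝ] ℂ)
  have he : (Complex.conjCLE : ℂ →L[ℝ] ℂ) (Complex.exp (t / 2 * (conj z - (conj z)⁻¹))) =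
      Complex.exp (conj t / 2 * (z - z⁻¹)) := by
    have h2 : conj (2 : ℂ) = 2 := map_ofNat _ 2
    simp [← Complex.exp_conj, h2]
  rw [he] at h
  refine h.congr_fun fun m => ?_
  simp

theorem summable_norm_besselJ_mul_zpow (t : ℂ) {R : ℝ} (hR : 0 < R) :
    Summable fun n : ℤ => ‖besselJ n t‖ * R ^ n := by
  refine (hasSum_besselJ t R (by exact_mod_cast hR.ne')).summable.norm.congr fun n => ?_
  rw [norm_mul, norm_zpow, Complex.norm_real, Real.norm_of_nonneg hR.le]

theorem summable_norm_besselJ (t : ℂ) : Summable fun n : ℤ => ‖besselJ n t‖ := by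
  simpa using summable_norm_besselJ_mul_zpow t one_pos

/-- The three term recurrence of the Bessel functions. -/
theorem besselJ_recurrence (t : ℂ) (n : ℤ) :
    t / 2 * (besselJ (n - 1) t + besselJ (n + 1) t) = n * besselJ n t := by
  let E : ℂ → ℂ := fun z => Complex.exp (t / 2 * (z - z⁻¹))
  have hE : ContinuousOn E (Metric.sphere (0 : ℂ) 1) := by
    have := (continuousOn_zpow_sphere one_pos (-1))
    simp only [zpow_neg_one] at this
    exact Complex.continuous_exp.comp_continuousOn
      (continuousOn_const.mul (continuousOn_id.sub this))
  have hint : ∀ m : ℤ, CircleIntegrable (fun z => E z * z ^ (-m - 1)) 0 1 := fun m =>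
    (hE.mul (continuousOn_zpow_sphere one_pos _)).circleIntegrable zero_le_one
  -- The three Bessel terms add up to the exact derivative of E(z) z^(-n), whose integral over the
  -- closed circle is zero.
  have hder : ∀ z ∈ Metric.sphere (0 : ℂ) 1, HasDerivWithinAt (fun z => E z * z ^ (-n))
      (t / 2 * (E z * z ^ (-(n - 1) - 1)) + t / 2 * (E z * z ^ (-(n + 1) - 1)) -
        n * (E z * z ^ (-n - 1))) (Metric.sphere 0 1) z := by
    intro z hz
    have hz0 := ne_zero_of_mem_sphere_zero one_pos hz
    have h1 : HasDerivAt E (E z * (t / 2 * (1 - -(z ^ 2)⁻¹))) z :=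
      (((hasDerivAt_id z).sub (hasDerivAt_inv hz0)).const_mul (t / 2)).cexp
    have h2 := h1.mul (hasDerivAt_zpow (-n) z (Or.inl hz0))
    refine (h2.congr_deriv ?_).hasDerivWithinAt
    have e1 : z ^ (-(n - 1) - 1) = z ^ (-n) := by congr 1; ring
    have e2 : z ^ (-(n + 1) - 1) = z ^ (-n) * (z ^ 2)⁻¹ := by
      rw [show -(n + 1) - 1 = -n + (-2 : ℤ) by ring, zpow_add₀ hz0, zpow_neg z 2]
      norm_cast
    rw [e1, e2]
    push_cast
    ring
  have h0 := circleIntegral.integral_eq_zero_of_hasDerivWithinAt zero_le_one hder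
  have hs : ∀ c : ℂ, ∀ m : ℤ, CircleIntegrable (fun z => c * (E z * z ^ (-m - 1))) 0 1 :=
    fun c m => (hint m).const_smul (a := c)
  have hs2 : CircleIntegrable (fun z => t / 2 * (E z * z ^ (-(n - 1) - 1)) +
      t / 2 * (E z * z ^ (-(n + 1) - 1))) 0 1 := (hs _ _).add (hs _ _)
  rw [circleIntegral.integral_sub hs2 (hs _ _),
    circleIntegral.integral_add (hs _ _) (hs _ _), circleIntegral.integral_const_mul,
    circleIntegral.integral_const_mul, circleIntegral.integral_const_mul,
    circleIntegral_exp_mul_zpow one_pos, circleIntegral_exp_mul_zpow one_pos,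
    circleIntegral_exp_mul_zpow one_pos] at h0
  refine mul_left_cancel₀ Complex.two_pi_I_ne_zero ?_
  linear_combination h0

/-- The kernel `∑ J_{a+k} J_{b+k}`, `k = 0, 1, 2, …`. -/
def besselSum (t : ℂ) (a b : ℤ) : ℂ := ∑' k : ℕ, besselJ (a + k) t * besselJ (b + k) t

theorem summable_norm_besselJ_nat (t : ℂ) (b : ℤ) :
    Summable fun k : ℕ => ‖besselJ (b + k) t‖ :=
  (summable_norm_besselJ t).comp_injective (i := fun k : ℕ => b + (k : ℤ))
    fun k l h => by simpa using h

theorem summable_besselJ_mul (t : ℂ) (a b : ℤ) :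
    Summable fun k : ℕ => besselJ (a + k) t * besselJ (b + k) t := by
  refine Summable.of_norm ?_
  simp only [norm_mul]
  exact ((summable_norm_besselJ_nat t a).mul_of_nonneg (summable_norm_besselJ_nat t b)
    (fun _ => norm_nonneg _) (fun _ => norm_nonneg _)).comp_injective
    (i := fun k : ℕ => (k, k)) fun k l h => congrArg Prod.fst h

/-- The Christoffel–Darboux type formula for the sum of products of Bessel functions. -/
theorem sub_mul_besselSum (t : ℂ) (a b : ℤ) :
    (a - b) * besselSum t a b =
      t / 2 * (besselJ (a - 1) t * besselJ b t - besselJ a t * besselJ (b - 1) t) := by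
  -- The boundary term at index k: the recurrence makes each summand D k - D (k+1), and D tends to
  -- zero because the Bessel functions do.
  let D : ℕ → ℂ := fun k => t / 2 *
    (besselJ (a + k - 1) t * besselJ (b + k) t - besselJ (a + k) t * besselJ (b + k - 1) t)
  have hstep : ∀ k : ℕ, (a - b : ℂ) * (besselJ (a + k) t * besselJ (b + k) t) = D k - D (k + 1) := by
    intro k
    have h1 := besselJ_recurrence t (a + k)
    have h2 := besselJ_recurrence t (b + k)
    simp only [D]
    have e1 : a + ((k + 1 : ℕ) : ℤ) = a + k + 1 := by push_cast; ring
    have e2 : b + ((k + 1 : ℕ) : ℤ) = b + k + 1 := by push_cast; ring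
    rw [e1, e2, add_sub_cancel_right, add_sub_cancel_right]
    push_cast at h1 h2
    linear_combination besselJ (a + k) t * h2 - besselJ (b + k) t * h1
  have hlim : ∀ c : ℤ, Tendsto (fun k : ℕ => besselJ (c + k) t) atTop (𝓝 0) := fun c =>
    tendsto_zero_iff_norm_tendsto_zero.2 (summable_norm_besselJ_nat t c).tendsto_atTop_zero
  have hD : Tendsto D atTop (𝓝 0) := by
    have h1 := hlim (a - 1)
    have h2 := hlim (b - 1)
    have := (((h1.mul (hlim b)).sub ((hlim a).mul h2)).const_mul (t / 2))
    simp only [mul_zero, sub_zero] at this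
    refine this.congr fun k => ?_
    simp only [D]
    rw [show a - 1 + (k : ℤ) = a + k - 1 by ring, show b - 1 + (k : ℤ) = b + k - 1 by ring]
  have hsum := ((summable_besselJ_mul t a b).hasSum.mul_left (a - b : ℂ)).tendsto_sum_nat
  simp only [hstep, Finset.sum_range_sub'] at hsum
  have h2 := tendsto_nhds_unique hsum (tendsto_const_nhds.sub hD)
  rw [besselSum, h2]
  simp [D]

/-- The double contour integral as a sum of products of Bessel functions. -/
theorem circleIntegral_circleIntegral_eq_besselSum (t : ℂ) {R r : ℝ} (hr : 0 < r) (hrR : r < R)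
    (a b : ℤ) :
    (∮ z in C(0, R), ∮ w in C(0, r), Complex.exp (t * (z - z⁻¹ - w + w⁻¹)) / (z - w) *
        (1 / (z ^ a * w ^ (1 - b)))) = (2 * π * Complex.I) ^ 2 * besselSum (2 * t) a b := by
  have hR : 0 < R := hr.trans hrR
  have hcE : ∀ (c : ℂ) {ρ : ℝ}, 0 < ρ → ∀ n : ℤ,
      ContinuousOn (fun z : ℂ => Complex.exp (c / 2 * (z - z⁻¹)) * z ^ n) (Metric.sphere 0 ρ) := by
    intro c ρ hρ n
    have := (continuousOn_zpow_sphere hρ (-1))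
    simp only [zpow_neg_one] at this
    exact (Complex.continuous_exp.comp_continuousOn
      (continuousOn_const.mul (continuousOn_id.sub this))).mul (continuousOn_zpow_sphere hρ n)
  -- Since |w| < |z|, 1/(z - w) = ∑ w^k / z^(k+1) converges geometrically. The w-integral of each
  -- term is J_{-(b+k)}(-2t) = J_{b+k}(2t), up to the factor 2πi.
  have hinner : ∀ z ∈ Metric.sphere (0 : ℂ) R, HasSum
      (fun k : ℕ => Complex.exp (2 * t / 2 * (z - z⁻¹)) * z ^ (-(a + k) - 1) *
        (2 * π * Complex.I * besselJ (b + k) (2 * t)))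
      (∮ w in C(0, r), Complex.exp (t * (z - z⁻¹ - w + w⁻¹)) / (z - w) *
        (1 / (z ^ a * w ^ (1 - b)))) := by
    intro z hz
    have hz0 := ne_zero_of_mem_sphere_zero hR hz
    have hzn : ‖z‖ = R := mem_sphere_zero_iff_norm.1 hz
    obtain ⟨C, hC⟩ := (isCompact_sphere (0 : ℂ) r).exists_bound_of_continuousOn
      (hcE (-(2 * t)) hr (b - 1))
    set A : ℂ := Complex.exp (2 * t / 2 * (z - z⁻¹)) * z ^ (-a - 1) with hA
    have h := hasSum_circleIntegral hr
      (F := fun (k : ℕ) w => Complex.exp (2 * t / 2 * (z - z⁻¹)) * z ^ (-(a + k) - 1) *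
        (Complex.exp (-(2 * t) / 2 * (w - w⁻¹)) * w ^ (-(-(b + k)) - 1)))
      (f := fun w => Complex.exp (t * (z - z⁻¹ - w + w⁻¹)) / (z - w) * (1 / (z ^ a * w ^ (1 - b))))
      (fun k => ‖A‖ * C * (r / R) ^ k)
      (fun k => continuousOn_const.mul (hcE (-(2 * t)) hr _)) ?_ ?_ ?_
    · refine h.congr_fun fun k => ?_
      rw [circleIntegral.integral_const_mul, circleIntegral_exp_mul_zpow hr, besselJ_neg_neg]
    · intro k w hw
      have hw0 := ne_zero_of_mem_sphere_zero hr hw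
      have hwn : ‖w‖ = r := mem_sphere_zero_iff_norm.1 hw
      have e : Complex.exp (2 * t / 2 * (z - z⁻¹)) * z ^ (-(a + k) - 1) *
        (Complex.exp (-(2 * t) / 2 * (w - w⁻¹)) * w ^ (-(-(b + k)) - 1)) =
        A * (Complex.exp (-(2 * t) / 2 * (w - w⁻¹)) * w ^ (b - 1)) * (w / z) ^ k := by
        rw [hA, show -(a + (k : ℤ)) - 1 = -a - 1 - k by ring, zpow_sub₀ hz0,
          show -(-(b + (k : ℤ))) - 1 = b - 1 + k by ring, zpow_add₀ hw0, zpow_natCast, zpow_natCast,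
          div_pow]
        ring
      rw [e, norm_mul, norm_mul, norm_pow, norm_div, hwn, hzn]
      have := hC w hw
      have hrR0 : 0 ≤ r / R := (div_pos hr hR).le
      gcongr
    · exact (summable_geometric_of_lt_one (div_pos hr hR).le ((div_lt_one hR).2 hrR)).mul_left _
    · intro w hw
      have hw0 := ne_zero_of_mem_sphere_zero hr hw
      have hwn : ‖w‖ = r := mem_sphere_zero_iff_norm.1 hw
      have hlt : ‖w / z‖ < 1 := by
        rw [norm_div, hwn, hzn]
        exact (div_lt_one hR).2 hrR
      have hzw : z - w ≠ 0 := by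
        rw [sub_ne_zero]
        rintro rfl
        exact hrR.ne (hwn.symm.trans hzn)
      have hg := (hasSum_geometric_of_norm_lt_one hlt).mul_left
        (A * (Complex.exp (-(2 * t) / 2 * (w - w⁻¹)) * w ^ (b - 1)))
      have e1 : A * (Complex.exp (-(2 * t) / 2 * (w - w⁻¹)) * w ^ (b - 1)) * (1 - w / z)⁻¹ =
          Complex.exp (t * (z - z⁻¹ - w + w⁻¹)) / (z - w) * (1 / (z ^ a * w ^ (1 - b))) := by
        have e2 : Complex.exp (t * (z - z⁻¹ - w + w⁻¹)) = Complex.exp (2 * t / 2 * (z - z⁻¹)) *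
            Complex.exp (-(2 * t) / 2 * (w - w⁻¹)) := by
          rw [← Complex.exp_add]
          congr 1
          ring
        have e3 : (1 - w / z)⁻¹ = z / (z - w) := by
          rw [one_sub_div hz0, inv_div]
        have e4 : w ^ (b - 1) = (w ^ (1 - b))⁻¹ := by
          rw [← zpow_neg]
          congr 1
          ring
        rw [hA, e2, e3, e4, zpow_sub₀ hz0, zpow_neg, zpow_one]
        have := zpow_ne_zero a hz0
        have := zpow_ne_zero (1 - b) hw0
        field_simp
      rw [e1] at hg
      refine hg.congr_fun fun k => ?_
      rw [hA, show -(a + (k : ℤ)) - 1 = -a - 1 - k by ring, zpow_sub₀ hz0,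
        show -(-(b + (k : ℤ))) - 1 = b - 1 + k by ring, zpow_add₀ hw0, zpow_natCast, zpow_natCast,
        div_pow]
      ring
  obtain ⟨C, hC⟩ := (isCompact_sphere (0 : ℂ) R).exists_bound_of_continuousOn
    (hcE (2 * t) hR (-a - 1))
  have hbs : Summable fun k : ℕ => ‖besselJ (b + k) (2 * t)‖ * R⁻¹ ^ k := by
    have h1 := ((summable_norm_besselJ_mul_zpow (2 * t) (inv_pos.2 hR)).comp_injective
      (i := fun k : ℕ => b + (k : ℤ)) fun k l h => by simpa using h).mul_right (R⁻¹ ^ (-b))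
    refine h1.congr fun k => ?_
    have hR' : R⁻¹ ≠ 0 := (inv_pos.2 hR).ne'
    rw [Function.comp_apply, mul_assoc, ← zpow_add₀ hR', ← zpow_natCast]
    congr 2
    ring
  have houter := hasSum_circleIntegral hR
    (F := fun (k : ℕ) z => Complex.exp (2 * t / 2 * (z - z⁻¹)) * z ^ (-(a + k) - 1) *
      (2 * π * Complex.I * besselJ (b + k) (2 * t)))
    (fun k => C * ‖(2 * π * Complex.I : ℂ)‖ * (‖besselJ (b + k) (2 * t)‖ * R⁻¹ ^ k))
    (fun k => (hcE (2 * t) hR _).mul continuousOn_const) ?_ (hbs.mul_left _) hinner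
  · have hval : ∀ k : ℕ, (∮ z in C(0, R), Complex.exp (2 * t / 2 * (z - z⁻¹)) *
        z ^ (-(a + k) - 1) * (2 * π * Complex.I * besselJ (b + k) (2 * t))) =
        (2 * π * Complex.I) ^ 2 * (besselJ (a + k) (2 * t) * besselJ (b + k) (2 * t)) := by
      intro k
      have : ∀ z : ℂ, Complex.exp (2 * t / 2 * (z - z⁻¹)) *
          z ^ (-(a + k) - 1) * (2 * π * Complex.I * besselJ (b + k) (2 * t)) =
          (2 * π * Complex.I * besselJ (b + k) (2 * t)) *
            (Complex.exp (2 * t / 2 * (z - z⁻¹)) * z ^ (-(a + k) - 1)) := fun z => mul_comm _ _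
      simp only [this]
      rw [circleIntegral.integral_const_mul, circleIntegral_exp_mul_zpow hR]
      ring
    simp only [hval] at houter
    exact houter.unique ((summable_besselJ_mul (2 * t) a b).hasSum.mul_left _)
  · intro k z hz
    have hz0 := ne_zero_of_mem_sphere_zero hR hz
    have hzn : ‖z‖ = R := mem_sphere_zero_iff_norm.1 hz
    have e : Complex.exp (2 * t / 2 * (z - z⁻¹)) * z ^ (-(a + k) - 1) *
        (2 * π * Complex.I * besselJ (b + k) (2 * t)) =
        Complex.exp (2 * t / 2 * (z - z⁻¹)) * z ^ (-a - 1) * (2 * π * Complex.I) *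
          (besselJ (b + k) (2 * t) * z⁻¹ ^ k) := by
      rw [show -(a + (k : ℤ)) - 1 = -a - 1 - k by ring, zpow_sub₀ hz0, zpow_natCast, inv_pow]
      ring
    rw [e, norm_mul, norm_mul _ (2 * π * Complex.I : ℂ), norm_mul (besselJ _ _), norm_pow, norm_inv,
      hzn]
    have := hC z hz
    have hRi : 0 ≤ R⁻¹ := (inv_pos.2 hR).le
    gcongr

end ContourIntegrals

/-! ### Exponential vectors in L² of the circle -/

section CircleModel

open Filter Topology AddCircle
open scoped ComplexConjugate

/-- Upgrades pointwise expansions to convergence in the uniform norm, which the continuous map to L²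
preserves. -/
theorem ContinuousMap.hasSum_of_summable_norm {X ι : Type*} [TopologicalSpace X] [CompactSpace X]
    {h : ι → C(X, ℂ)} {F : C(X, ℂ)} (hs : Summable fun i => ‖h i‖)
    (hp : ∀ x, HasSum (fun i => h i x) (F x)) : HasSum h F := by
  have h1 := (Summable.of_norm hs).hasSum
  have h2 : ∑' i, h i = F := by
    ext x
    exact (h1.mapL (ContinuousMap.evalCLM ℂ x)).unique (hp x)
  rwa [h2] at h1

theorem fourier_add_mul_apply (k l : ℤ) (m : ℕ) (x : UnitAddCircle) :
    fourier (k + m * l) x = fourier k x * (fourier l x : ℂ) ^ m := by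
  induction m with
  | zero => simp
  | succ m ih =>
    rw [show k + ((m + 1 : ℕ) : ℤ) * l = (k + m * l) + l by push_cast; ring, fourier_add, ih,
      pow_succ, mul_assoc]

/-- The function `z ^ (-k) * exp (a * z + b / z)` on the circle. -/
def expCircle (a b : ℂ) (k : ℤ) : C(UnitAddCircle, ℂ) where
  toFun x := fourier (-k) x * Complex.exp (a * fourier 1 x + b * fourier (-1) x)

theorem expCircle_apply (a b : ℂ) (k : ℤ) (x : UnitAddCircle) :
    expCircle a b k x = fourier (-k) x * Complex.exp (a * fourier 1 x + b * fourier (-1) x) := rfl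

theorem norm_expCircle_le (a b : ℂ) (k : ℤ) : ‖expCircle a b k‖ ≤ Real.exp (‖a‖ + ‖b‖) := by
  have hf : ∀ (n : ℤ) (x : UnitAddCircle), ‖(fourier n x : ℂ)‖ = 1 := fun n x => Circle.norm_coe _
  rw [ContinuousMap.norm_le _ (Real.exp_pos _).le]
  intro x
  rw [expCircle_apply, norm_mul, hf, one_mul]
  refine (Complex.norm_exp_le_exp_norm _).trans (Real.exp_le_exp.2 ((norm_add_le _ _).trans ?_))
  rw [norm_mul, norm_mul, hf, hf, mul_one, mul_one]

/-- The Hilbert space of square integrable functions on the circle. -/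
abbrev CircleL2 : Type := Lp ℂ 2 (@haarAddCircle 1 _)

/-- The function `z ^ (-k) * exp (a * z + b / z)` as a vector of `L²`. -/
def expVec (a b : ℂ) (k : ℤ) : CircleL2 :=
  ContinuousMap.toLp (E := ℂ) 2 haarAddCircle ℂ (expCircle a b k)

theorem expVec_zero_zero (k : ℤ) : expVec 0 0 k = fourierLp 2 (-k) := by
  rw [expVec, fourierLp]
  congr 1
  ext x
  simp [expCircle_apply]

theorem summable_norm_pow_div_smul_expCircle (c a b : ℂ) (k : ℕ → ℤ) :
    Summable fun m : ℕ => ‖(c ^ m / (m ! : ℂ)) • expCircle a b (k m)‖ := by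
  refine Summable.of_nonneg_of_le (fun _ => norm_nonneg _) (fun m => ?_)
    ((NormedSpace.norm_expSeries_div_summable (𝔸 := ℂ) c).mul_right (Real.exp (‖a‖ + ‖b‖)))
  rw [norm_smul]
  exact mul_le_mul_of_nonneg_left (norm_expCircle_le a b _) (norm_nonneg _)

/-- Multiplication by e^(c/z), expanded in powers of 1/z: only indices at least `k` occur. -/
theorem hasSum_expVec_neg (c a b : ℂ) (k : ℤ) :
    HasSum (fun m : ℕ => (c ^ m / (m ! : ℂ)) • expVec a b (k + m)) (expVec a (b + c) k) := by
  have h := ContinuousMap.hasSum_of_summable_norm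
    (summable_norm_pow_div_smul_expCircle c a b fun m => k + m)
    (F := expCircle a (b + c) k) fun x => ?_
  · have := h.mapL (ContinuousMap.toLp (E := ℂ) 2 (@haarAddCircle 1 _) ℂ)
    simp only [map_smul] at this
    exact this
  · have h1 := (NormedSpace.expSeries_div_hasSum_exp (c * (fourier (-1) x : ℂ))).mul_left
      (expCircle a b k x)
    rw [← Complex.exp_eq_exp_ℂ] at h1
    have h2 : expCircle a b k x * Complex.exp (c * (fourier (-1) x : ℂ)) =
        expCircle a (b + c) k x := by
      rw [expCircle_apply, expCircle_apply, mul_assoc, ← Complex.exp_add]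
      congr 2
      ring
    rw [h2] at h1
    refine h1.congr_fun fun m => ?_
    rw [ContinuousMap.smul_apply, expCircle_apply, expCircle_apply, smul_eq_mul,
      show -(k + (m : ℤ)) = -k + m * (-1) by ring, fourier_add_mul_apply]
    ring

theorem hasSum_expVec_pos (c a b : ℂ) (k : ℤ) :
    HasSum (fun m : ℕ => (c ^ m / (m ! : ℂ)) • expVec a b (k - m)) (expVec (a + c) b k) := by
  have h := ContinuousMap.hasSum_of_summable_norm
    (summable_norm_pow_div_smul_expCircle c a b fun m => k - m)
    (F := expCircle (a + c) b k) fun x => ?_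
  · have := h.mapL (ContinuousMap.toLp (E := ℂ) 2 (@haarAddCircle 1 _) ℂ)
    simp only [map_smul] at this
    exact this
  · have h1 := (NormedSpace.expSeries_div_hasSum_exp (c * (fourier 1 x : ℂ))).mul_left
      (expCircle a b k x)
    rw [← Complex.exp_eq_exp_ℂ] at h1
    have h2 : expCircle a b k x * Complex.exp (c * (fourier 1 x : ℂ)) =
        expCircle (a + c) b k x := by
      rw [expCircle_apply, expCircle_apply, mul_assoc, ← Complex.exp_add]
      congr 2
      ring
    rw [h2] at h1
    refine h1.congr_fun fun m => ?_
    rw [ContinuousMap.smul_apply, expCircle_apply, expCircle_apply, smul_eq_mul,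
      show -(k - (m : ℤ)) = -k + m * 1 by ring, fourier_add_mul_apply]
    ring

theorem inner_fourierLp_fourierLp (m n : ℤ) :
    inner ℂ (fourierLp (T := (1 : ℝ)) 2 m) (fourierLp 2 n) = if m = n then 1 else 0 :=
  orthonormal_iff_ite.1 orthonormal_fourier m n

/-- The Fourier coefficients of `z ^ (-k) * exp (t * z)`. -/
theorem inner_fourierLp_expVec_zero (t : ℂ) (s k : ℤ) :
    inner ℂ (fourierLp (T := (1 : ℝ)) 2 s) (expVec t 0 k) = expCoeff t (s + k) := by
  have h := (hasSum_expVec_pos t 0 0 k).mapL (innerSL ℂ (fourierLp (T := (1 : ℝ)) 2 s))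
  rw [zero_add] at h
  simp only [innerSL_apply_apply, inner_smul_right, expVec_zero_zero,
    inner_fourierLp_fourierLp] at h
  by_cases hs : 0 ≤ s + k
  · obtain ⟨n, hn⟩ := Int.eq_ofNat_of_zero_le hs
    rw [hn, expCoeff_natCast]
    refine h.unique ?_
    convert! hasSum_ite_eq n (t ^ n / (n ! : ℂ)) using 2 with m
    by_cases hm : m = n
    · subst hm
      rw [if_pos (by omega), if_pos rfl, mul_one]
    · rw [if_neg (by omega), if_neg hm, mul_zero]
  · rw [expCoeff_of_neg t (by omega)]
    refine h.unique ?_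
    convert! hasSum_zero with m
    rw [if_neg (by omega), mul_zero]

theorem fourier_eq_zpow (n : ℤ) (x : UnitAddCircle) :
    (fourier n x : ℂ) = (fourier 1 x : ℂ) ^ n := by
  rw [fourier_apply, fourier_apply, one_zsmul, toCircle_zsmul, Circle.coe_zpow]

/-- The Fourier coefficients of `z ^ (-k) * exp (t * (z - 1 / z))`. -/
theorem inner_fourierLp_expVec_neg (t : ℂ) (s k : ℤ) :
    inner ℂ (fourierLp (T := (1 : ℝ)) 2 s) (expVec t (-t) k) = besselJ (s + k) (2 * t) := by
  have hF : HasSum (fun n : ℤ => besselJ n (2 * t) • (fourier (n - k) : C(UnitAddCircle, ℂ)))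
      (expCircle t (-t) k) := by
    refine ContinuousMap.hasSum_of_summable_norm ?_ fun x => ?_
    · simpa only [norm_smul, fourier_norm, mul_one] using summable_norm_besselJ (2 * t)
    · have hx : (fourier 1 x : ℂ) ≠ 0 := Circle.coe_ne_zero _
      have h1 := (hasSum_besselJ (2 * t) (fourier 1 x) hx).mul_left (fourier (-k) x : ℂ)
      rw [expCircle_apply, fourier_eq_zpow (-1) x, zpow_neg_one,
        show t * (fourier 1 x : ℂ) + -t * (fourier 1 x : ℂ)⁻¹ =
          2 * t / 2 * ((fourier 1 x : ℂ) - (fourier 1 x : ℂ)⁻¹) by ring]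
      refine h1.congr_fun fun n => ?_
      rw [ContinuousMap.smul_apply, smul_eq_mul, fourier_eq_zpow (n - k) x, fourier_eq_zpow (-k) x,
        sub_eq_neg_add, zpow_add₀ hx]
      ring
  have h := (hF.mapL (ContinuousMap.toLp (E := ℂ) 2 (@haarAddCircle 1 _) ℂ)).mapL
    (innerSL ℂ (fourierLp (T := (1 : ℝ)) 2 s))
  simp only [map_smul, innerSL_apply_apply] at h
  refine h.unique ?_
  convert! hasSum_ite_eq (s + k) (besselJ (s + k) (2 * t)) using 2 with n
  rw [inner_fourierLp_fourierLp, smul_eq_mul]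
  by_cases hn : n = s + k
  · subst hn
    rw [if_pos (by ring), if_pos rfl, mul_one]
  · rw [if_neg (by omega), if_neg hn, mul_zero]

/-- Multiplication by the unimodular function `exp (t * (z - 1 / z))`, `t` real, is unitary. -/
theorem inner_expVec_expVec (t : ℝ) (j k : ℤ) :
    inner ℂ (expVec t (-t) j) (expVec t (-t) k) = if j = k then 1 else 0 := by
  have h1 := inner_fourierLp_fourierLp (-j) (-k)
  rw [ContinuousMap.inner_toLp (@haarAddCircle 1 _)] at h1
  simp only [neg_inj] at h1
  rw [expVec, expVec, ContinuousMap.inner_toLp (@haarAddCircle 1 _)]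
  rw [← h1]
  congr 1
  funext x
  -- On the unit circle 1/z is the conjugate of z, so the exponent is purely imaginary for real t.
  have hE : Complex.exp (t * fourier 1 x + -t * fourier (-1) x) *
      conj (Complex.exp (t * fourier 1 x + -t * fourier (-1) x)) = 1 := by
    rw [← Complex.exp_conj, ← Complex.exp_add, fourier_neg]
    simp
  rw [expCircle_apply, expCircle_apply, map_mul]
  linear_combination (fourier (-k) x * conj (fourier (-j) x)) * hE

/-- The span of the first `N` of the vectors `z ^ (-j) * exp (t * z)`. -/
def expSpan (t : ℂ) (N : ℕ) : Submodule ℂ CircleL2 :=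
  Submodule.span ℂ (Set.range fun i : Fin N => expVec t 0 (i : ℕ))

instance (t : ℂ) (N : ℕ) : FiniteDimensional ℂ (expSpan t N) :=
  FiniteDimensional.span_of_finite ℂ (Set.finite_range _)

theorem expSpan_mono (t : ℂ) : Monotone (expSpan t) := by
  intro M N h
  refine Submodule.span_mono ?_
  rintro _ ⟨i, rfl⟩
  exact ⟨⟨i, i.2.trans_le h⟩, rfl⟩

theorem expVec_mem_closure (t : ℂ) (k : ℕ) :
    expVec t 0 k ∈ (⨆ N, expSpan t N).topologicalClosure :=
  Submodule.le_topologicalClosure _ (Submodule.mem_iSup_of_mem (k + 1)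
    (Submodule.subset_span ⟨⟨k, Nat.lt_succ_self k⟩, rfl⟩))

/-- The factor e^(-t/z) contributes only nonnegative powers of 1/z, so the expansion stays among the
spanning vectors. -/
theorem expVec_neg_mem_closure (t : ℂ) (k : ℕ) :
    expVec t (-t) k ∈ (⨆ N, expSpan t N).topologicalClosure := by
  have h := hasSum_expVec_neg (-t) t 0 k
  rw [zero_add] at h
  refine (Submodule.isClosed_topologicalClosure _).mem_of_tendsto h
    (Eventually.of_forall fun s => Submodule.sum_mem _ fun m _ => Submodule.smul_mem _ _ ?_)
  exact_mod_cast expVec_mem_closure t (k + m)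

end CircleModel

/-! ### Projections, Gram matrices and the two limits -/

section Limit

open Filter Topology AddCircle YoungDiagram
open scoped ComplexConjugate

theorem expSpan_le_orthogonal {t : ℂ} {y : CircleL2}
    (hy : ∀ k : ℕ, inner ℂ y (expVec t 0 k) = 0) (N : ℕ) : expSpan t N ≤ (ℂ ∙ y)ᗮ := by
  refine Submodule.span_le.2 ?_
  rintro _ ⟨i, rfl⟩
  exact Submodule.mem_orthogonal_singleton_iff_inner_right.2 (hy i)

theorem conj_besselJ_two_mul_ofReal (n : ℤ) (t : ℝ) :
    conj (besselJ n (2 * (t : ℂ))) = besselJ n (2 * t) := by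
  rw [conj_besselJ, map_mul, Complex.conj_ofReal, map_ofNat]

/-- The Bessel kernel is the kernel of the projection to the span of all `z ^ (-k) * exp (t * z)`. -/
theorem inner_starProjection_closure (t : ℝ) (a b : ℤ) :
    inner ℂ (fourierLp (T := (1 : ℝ)) 2 a)
      ((⨆ N, expSpan t N).topologicalClosure.starProjection (fourierLp 2 b)) =
        besselSum (2 * t) a b := by
  have hnorm : ∀ k : ℤ, ‖expVec t (-t) k‖ = 1 := by
    intro k
    have h := inner_expVec_expVec t k k
    rw [if_pos rfl, inner_self_eq_norm_sq_to_K] at h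
    have h2 : ‖expVec (t : ℂ) (-t) k‖ ^ 2 = 1 := Complex.ofReal_eq_one.1 (by
      rw [Complex.ofReal_pow]
      exact h)
    exact (pow_eq_one_iff_of_nonneg (norm_nonneg _) two_ne_zero).1 h2
  have hs : Summable fun k : ℕ => besselJ (b + k) (2 * t) • expVec (t : ℂ) (-t) k := by
    refine Summable.of_norm ?_
    simpa only [norm_smul, hnorm, mul_one] using summable_norm_besselJ_nat (2 * t) b
  -- The orthonormal expansion that should be the projection of the b-th Fourier mode. Its
  -- coefficients are Bessel values, real because t is real.
  set v : CircleL2 := ∑' k : ℕ, besselJ (b + k) (2 * t) • expVec (t : ℂ) (-t) k with hv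
  have hsum := hs.hasSum
  rw [← hv] at hsum
  have hmem : v ∈ (⨆ N, expSpan (t : ℂ) N).topologicalClosure :=
    (Submodule.isClosed_topologicalClosure _).mem_of_tendsto hsum
      (Eventually.of_forall fun s => Submodule.sum_mem _ fun m _ => Submodule.smul_mem _ _
        (expVec_neg_mem_closure t m))
  have hu : ∀ j : ℕ, inner ℂ (fourierLp 2 b - v) (expVec (t : ℂ) (-t) j) = 0 := by
    intro j
    have h1 : inner ℂ (expVec (t : ℂ) (-t) j) v = besselJ (b + j) (2 * t) := by
      have h := hsum.mapL (innerSL ℂ (expVec (t : ℂ) (-t) j))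
      simp only [innerSL_apply_apply, inner_smul_right, inner_expVec_expVec] at h
      refine h.unique ?_
      convert! hasSum_ite_eq j (besselJ (b + j) (2 * t)) using 2 with k
      by_cases hk : k = j
      · subst hk
        simp
      · rw [if_neg (by omega), if_neg hk, mul_zero]
    rw [inner_sub_left, inner_fourierLp_expVec_neg, ← inner_conj_symm v, h1,
      conj_besselJ_two_mul_ofReal, sub_self]
  -- The converse change of basis: multiplication by e^(t/z) expresses z^(-k) e^(tz) through the
  -- orthonormal vectors, so the residual is orthogonal to the original spanning set.
  have hphi : ∀ k : ℕ, inner ℂ (fourierLp 2 b - v) (expVec (t : ℂ) 0 k) = 0 := by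
    intro k
    have h := (hasSum_expVec_neg t t (-t) k).mapL (innerSL ℂ (fourierLp 2 b - v))
    rw [neg_add_cancel] at h
    refine h.unique ?_
    convert! hasSum_zero with m
    rw [map_smul, innerSL_apply_apply]
    have := hu (k + m)
    push_cast at this
    rw [this, smul_zero]
  have hle : (⨆ N, expSpan (t : ℂ) N).topologicalClosure ≤ (ℂ ∙ (fourierLp 2 b - v))ᗮ :=
    Submodule.topologicalClosure_minimal _ (iSup_le (expSpan_le_orthogonal hphi))
      (Submodule.isClosed_orthogonal _)
  have hproj := Submodule.eq_starProjection_of_mem_of_inner_eq_zero hmem fun w hw =>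
    Submodule.mem_orthogonal_singleton_iff_inner_right.1 (hle hw)
  rw [hproj]
  have h := hsum.mapL (innerSL ℂ (fourierLp (T := (1 : ℝ)) 2 a))
  simp only [innerSL_apply_apply, inner_smul_right, inner_fourierLp_expVec_neg] at h
  refine h.unique ?_
  exact (summable_besselJ_mul (2 * t) a b).hasSum.congr_fun fun k => mul_comm _ _

theorem tendsto_inner_starProjection (t : ℝ) (a b : ℤ) :
    Tendsto (fun N => inner ℂ (fourierLp (T := (1 : ℝ)) 2 a)
      ((expSpan t N).starProjection (fourierLp 2 b))) atTop (𝓝 (besselSum (2 * t) a b)) := by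
  rw [← inner_starProjection_closure]
  exact tendsto_const_nhds.inner
    (Submodule.starProjection_tendsto_closure_iSup (expSpan (t : ℂ)) (expSpan_mono t) _)

theorem conj_expCoeff (t : ℝ) (m : ℤ) : conj (expCoeff t m) = expCoeff t m := by
  unfold expCoeff
  split_ifs <;> simp

/-- The Gram matrix of the vectors `z ^ (-j) * exp (t * z)`. -/
def expGram (t : ℂ) (N : ℕ) : Matrix (Fin N) (Fin N) ℂ :=
  Matrix.of fun i j => inner ℂ (expVec t 0 (i : ℕ)) (expVec t 0 (j : ℕ))

theorem inner_expVec_zero_fourierLp (t : ℝ) (s k : ℤ) :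
    inner ℂ (expVec t 0 k) (fourierLp (T := (1 : ℝ)) 2 s) = expCoeff t (s + k) := by
  rw [← inner_conj_symm, inner_fourierLp_expVec_zero, conj_expCoeff]

theorem hasSum_expGram (t : ℝ) {N : ℕ} (i j : Fin N) :
    HasSum (fun s : ℤ => expCoeff t (s + (i : ℕ)) * expCoeff t (s + (j : ℕ))) (expGram t N i j) := by
  have h := (fourierBasis (T := (1 : ℝ))).hasSum_inner_mul_inner
    (expVec t 0 (i : ℕ)) (expVec t 0 (j : ℕ))
  simp only [coe_fourierBasis, inner_expVec_zero_fourierLp, inner_fourierLp_expVec_zero] at h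
  exact h

/-- The kernel of the projection to a finite span through the Gram matrix. -/
theorem sum_expCoeff_mul_inv_expGram (t : ℝ) {N : ℕ} (hdet : (expGram t N).det ≠ 0) (a b : ℤ) :
    ∑ i : Fin N, ∑ j : Fin N,
      expCoeff t (a + (i : ℕ)) * (expGram t N)⁻¹ i j * expCoeff t (b + (j : ℕ)) =
    inner ℂ (fourierLp (T := (1 : ℝ)) 2 a) ((expSpan t N).starProjection (fourierLp 2 b)) := by
  set f : Fin N → ℂ := fun j => expCoeff t (b + (j : ℕ)) with hf
  -- The coefficients of the projection, found by solving the normal equations.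
  set c : Fin N → ℂ := Matrix.mulVec (expGram t N)⁻¹ f with hc
  have hGc : Matrix.mulVec (expGram t N) c = f := by
    rw [hc, Matrix.mulVec_mulVec, Matrix.mul_nonsing_inv _ (isUnit_iff_ne_zero.2 hdet),
      Matrix.one_mulVec]
  set v : CircleL2 := ∑ i : Fin N, c i • expVec t 0 (i : ℕ) with hv
  have hmem : v ∈ expSpan (t : ℂ) N := Submodule.sum_mem _ fun i _ =>
    Submodule.smul_mem _ _ (Submodule.subset_span ⟨i, rfl⟩)
  have hphi : ∀ k : Fin N, inner ℂ (fourierLp 2 b - v) (expVec (t : ℂ) 0 (k : ℕ)) = 0 := by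
    intro k
    rw [← inner_conj_symm, inner_sub_right, inner_expVec_zero_fourierLp, hv, inner_sum]
    simp only [inner_smul_right]
    have := congrFun hGc k
    simp only [Matrix.mulVec, dotProduct, expGram, Matrix.of_apply, hf] at this
    rw [← this, map_eq_zero, sub_eq_zero]
    exact Finset.sum_congr rfl fun i _ => mul_comm _ _
  have hle : expSpan (t : ℂ) N ≤ (ℂ ∙ (fourierLp 2 b - v))ᗮ := by
    refine Submodule.span_le.2 ?_
    rintro _ ⟨i, rfl⟩
    exact Submodule.mem_orthogonal_singleton_iff_inner_right.2 (hphi i)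
  rw [Submodule.eq_starProjection_of_mem_of_inner_eq_zero hmem fun w hw =>
    Submodule.mem_orthogonal_singleton_iff_inner_right.1 (hle hw), hv, inner_sum]
  refine Finset.sum_congr rfl fun i _ => ?_
  rw [inner_smul_right, inner_fourierLp_expVec_zero, hc, Matrix.mulVec, dotProduct, Finset.sum_mul]
  refine Finset.sum_congr rfl fun j _ => ?_
  ring

theorem jacobiTrudiDet_sq {ξ : ℝ} (hξ : 0 ≤ ξ) {N : ℕ} {lam : YoungDiagram}
    (hN : lam.rowLen N = 0) :
    jacobiTrudiDet (√ξ : ℝ) N lam ^ 2 =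
      ((Real.exp ξ * poissonPlancherelWeight ξ lam : ℝ) : ℂ) := by
  rw [jacobiTrudiDet_eq _ hN, poissonPlancherelWeight, ← mul_assoc, ← mul_assoc, ← Real.exp_add,
    add_neg_cancel, Real.exp_zero, one_mul, mul_pow, ← pow_mul, mul_comm _ 2, pow_mul,
    ← Complex.ofReal_pow, Real.sq_sqrt hξ]
  push_cast
  rfl

open Classical in
/-- Sums over decreasing tuples in growing windows are sums over diagrams with at most `N` rows. -/
theorem hasSum_diagram_of_tendsto {ξ : ℝ} (hξ : 0 ≤ ξ) {N : ℕ} {c : (Fin N → ℤ) → ℂ} {L : ℂ}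
    (hc : ∀ g, ‖c g‖ ≤ 1)
    (hL : Tendsto (fun W : Finset ℤ =>
      ∑ g ∈ Fintype.piFinset (fun _ : Fin N => W) with StrictAnti g,
        Matrix.det (Matrix.of fun i j : Fin N => expCoeff (√ξ : ℝ) (g j + (i : ℕ))) ^ 2 * c g)
      atTop (𝓝 L)) :
    HasSum (fun lam : YoungDiagram => if lam.rowLen N = 0 then
      ((Real.exp ξ * poissonPlancherelWeight ξ lam : ℝ) : ℂ) * c (fun i => shiftedRow lam i)
      else 0) L := by
  let F : (Fin N → ℤ) → ℂ := fun g => if StrictAnti g then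
    Matrix.det (Matrix.of fun i j : Fin N => expCoeff (√ξ : ℝ) (g j + (i : ℕ))) ^ 2 * c g else 0
  let e : {lam : YoungDiagram // lam.rowLen N = 0} → (Fin N → ℤ) :=
    fun lam i => shiftedRow lam.1 i
  have he : Function.Injective e := fun lam mu h =>
    Subtype.ext (eq_of_shiftedRow_eq lam.2 mu.2 fun i => congrFun h i)
  -- Cauchy–Binet puts the points in the columns, the dimension formula puts them in the rows.
  have htr : ∀ g : Fin N → ℤ,
      Matrix.det (Matrix.of fun i j : Fin N => expCoeff (√ξ : ℝ) (g j + (i : ℕ))) =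
      Matrix.det (Matrix.of fun i j : Fin N => expCoeff (√ξ : ℝ) (g i + (j : ℕ))) := fun g =>
    (Matrix.det_transpose _).symm
  have hFe : ∀ lam, F (e lam) =
      ((Real.exp ξ * poissonPlancherelWeight ξ lam.1 : ℝ) : ℂ) * c (e lam) := by
    intro lam
    have hanti : StrictAnti (e lam) := fun i j hij => shiftedRow_strictAnti lam.1 hij
    simp only [F]
    rw [if_pos hanti, htr, ← jacobiTrudiDet_sq hξ lam.2]
    rfl
  have hW := (hasSum_poissonPlancherelWeight hξ).summable.mul_left (Real.exp ξ)
  -- The hypothesis gives a limit only along the windows W^N. Domination by the weights gives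
  -- unconditional summability, so the two limits can be compared.
  have hsub : Summable (F ∘ e) := by
    refine Summable.of_norm_bounded (hW.comp_injective Subtype.val_injective) fun lam => ?_
    rw [Function.comp_apply, hFe, norm_mul, Complex.norm_real, Real.norm_of_nonneg
      (mul_nonneg (Real.exp_pos _).le (poissonPlancherelWeight_nonneg hξ _))]
    exact mul_le_of_le_one_right
      (mul_nonneg (Real.exp_pos _).le (poissonPlancherelWeight_nonneg hξ _)) (hc _)
  have hsupp : ∀ g ∉ Set.range e, F g = 0 := by
    intro g hg
    simp only [F]
    split_ifs with hanti
    · by_contra hne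
      have hdet : Matrix.det (Matrix.of fun i j : Fin N =>
          expCoeff (√ξ : ℝ) (g i + (j : ℕ))) ≠ 0 := by
        rw [← htr]
        intro h0
        exact hne (by rw [h0]; ring)
      obtain ⟨lam, h1, h2⟩ := exists_shiftedRow_of_det_ne_zero hanti hdet
      exact hg ⟨⟨lam, h1⟩, funext h2⟩
    · rfl
  have hF : HasSum F (∑' lam, F (e lam)) := (he.hasSum_iff hsupp).1 hsub.hasSum
  -- The cubes W^N are cofinal: any finite set of tuples lies in the cube over the set of their
  -- entries.
  have hpi : Tendsto (fun W : Finset ℤ => Fintype.piFinset (fun _ : Fin N => W)) atTop atTop := by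
    refine Monotone.tendsto_atTop_atTop
      (fun W V h => Fintype.piFinset_subset _ _ fun _ => h) fun S => ?_
    refine ⟨S.biUnion fun g => Finset.univ.image g, fun g hg => Fintype.mem_piFinset.2 fun i => ?_⟩
    exact Finset.mem_biUnion.2 ⟨g, hg, Finset.mem_image_of_mem _ (Finset.mem_univ i)⟩
  have hF' : Tendsto (fun s : Finset (Fin N → ℤ) => ∑ g ∈ s, F g) atTop
      (𝓝 (∑' lam, F (e lam))) := hF
  have hlim : Tendsto (fun W : Finset ℤ => ∑ g ∈ Fintype.piFinset (fun _ : Fin N => W), F g) atTop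
      (𝓝 (∑' lam, F (e lam))) := hF'.comp hpi
  have hval : ∑' lam, F (e lam) = L := by
    refine tendsto_nhds_unique hlim (hL.congr fun W => ?_)
    rw [Finset.sum_filter]
  have hfin : HasSum (F ∘ e) L := hval ▸ hsub.hasSum
  refine ((Subtype.val_injective (p := fun lam : YoungDiagram => lam.rowLen N = 0)).hasSum_iff
    fun lam hlam => ?_).1 (hfin.congr_fun fun lam => ?_)
  · exact if_neg fun h => hlam ⟨⟨lam, h⟩, rfl⟩
  · rw [Function.comp_apply, Function.comp_apply, hFe, if_pos lam.2]

/-! ### From finite windows to all integers -/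

/-- The Gram matrix of the restrictions to a finite window of Fourier modes. -/
def windowGram (t : ℂ) (N : ℕ) (W : Finset ℤ) : Matrix (Fin N) (Fin N) ℂ :=
  Matrix.of fun i j => ∑ s ∈ W, expCoeff t (s + (i : ℕ)) * expCoeff t (s + (j : ℕ))

theorem tendsto_windowGram (t : ℝ) (N : ℕ) :
    Tendsto (windowGram t N) atTop (𝓝 (expGram t N)) :=
  tendsto_pi_nhds.2 fun i => tendsto_pi_nhds.2 fun j => hasSum_expGram t i j

theorem tendsto_det_windowGram (t : ℝ) (N : ℕ) :
    Tendsto (fun W => (windowGram t N W).det) atTop (𝓝 (expGram t N).det) :=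
  ((continuous_id.matrix_det).tendsto (expGram t N)).comp (tendsto_windowGram t N)

/-- By Cauchy–Binet the determinant is a sum of nonnegative terms, and the empty diagram alone
contributes e^ξ · e^(-ξ) = 1. -/
theorem det_expGram_ne_zero {ξ : ℝ} (hξ : 0 ≤ ξ) (N : ℕ) : (expGram (√ξ : ℝ) N).det ≠ 0 := by
  have hL := tendsto_det_windowGram (√ξ) N
  have h := hasSum_diagram_of_tendsto hξ (N := N) (c := fun _ => 1) (fun _ => by simp) (hL.congr fun W => ?_)
  · simp only [mul_one] at h
    have h2 : HasSum (fun lam : YoungDiagram => (((if lam.rowLen N = 0 then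
      (Real.exp ξ * poissonPlancherelWeight ξ lam : ℝ) else 0 : ℝ)) : ℂ))
        (expGram (√ξ : ℝ) N).det := by
      refine h.congr_fun fun lam => ?_
      split_ifs <;> simp
    have h3 := h2.mapL Complex.reCLM
    simp only [Complex.reCLM_apply, Complex.ofReal_re] at h3
    intro h0
    rw [h0, Complex.zero_re] at h3
    have h4 := le_hasSum h3 ⊥ fun lam _ => by
      split_ifs
      exacts [mul_nonneg (Real.exp_pos _).le (poissonPlancherelWeight_nonneg hξ _), le_rfl]
    rw [if_pos (rowLen_bot N), poissonPlancherelWeight, dimDiagram_bot] at h4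
    simp [YoungDiagram.card, ← Real.exp_add] at h4
    linarith
  · simp only [mul_one, sq]
    exact det_sum_mul_eq_sum_strictAnti W _ _

theorem tendsto_inv_windowGram {ξ : ℝ} (hξ : 0 ≤ ξ) (N : ℕ) :
    Tendsto (fun W => (windowGram (√ξ : ℝ) N W)⁻¹) atTop (𝓝 (expGram (√ξ : ℝ) N)⁻¹) := by
  simp only [Matrix.inv_def, Ring.inverse_eq_inv']
  exact ((tendsto_det_windowGram _ N).inv₀ (det_expGram_ne_zero hξ N)).smul
    (((continuous_id.matrix_adjugate).tendsto _).comp (tendsto_windowGram _ N))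

open Classical in
theorem hasSum_diagram_det {ξ : ℝ} (hξ : 0 ≤ ξ) (N : ℕ) {n : ℕ} {x : Fin n → ℤ}
    (hx : Function.Injective x) :
    HasSum (fun lam : YoungDiagram => if lam.rowLen N = 0 then
      ((Real.exp ξ * poissonPlancherelWeight ξ lam : ℝ) : ℂ) *
        (if Set.range x ⊆ Set.range (fun i : Fin N => shiftedRow lam i) then 1 else 0) else 0)
      ((expGram (√ξ : ℝ) N).det * Matrix.det (Matrix.of fun k l : Fin n =>
        inner ℂ (fourierLp (T := (1 : ℝ)) 2 (x k))
          ((expSpan (√ξ : ℝ) N).starProjection (fourierLp 2 (x l))))) := by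
  refine hasSum_diagram_of_tendsto hξ
    (c := fun g => if Set.range x ⊆ Set.range g then 1 else 0)
    (fun g => by split_ifs <;> simp) ?_
  have hdet := tendsto_det_windowGram (√ξ) N
  have hK : Tendsto (fun W => (Matrix.of fun k l : Fin n => ∑ i : Fin N, ∑ j : Fin N,
      expCoeff (√ξ : ℝ) (x k + (i : ℕ)) * (windowGram (√ξ : ℝ) N W)⁻¹ i j *
        expCoeff (√ξ : ℝ) (x l + (j : ℕ)))) atTop
      (𝓝 (Matrix.of fun k l : Fin n => inner ℂ (fourierLp (T := (1 : ℝ)) 2 (x k))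
          ((expSpan (√ξ : ℝ) N).starProjection (fourierLp 2 (x l))))) := by
    refine tendsto_pi_nhds.2 fun k => tendsto_pi_nhds.2 fun l => ?_
    simp only [Matrix.of_apply]
    rw [← sum_expCoeff_mul_inv_expGram _ (det_expGram_ne_zero hξ N)]
    refine tendsto_finsetSum _ fun i _ => tendsto_finsetSum _ fun j _ => ?_
    exact (tendsto_const_nhds.mul
      (tendsto_pi_nhds.1 (tendsto_pi_nhds.1 (tendsto_inv_windowGram hξ N) i) j)).mul
      tendsto_const_nhds
  refine (hdet.mul (((continuous_id.matrix_det).tendsto _).comp hK)).congr' ?_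
  -- The finite identity needs a window that contains the points and has an invertible Gram matrix;
  -- both hold eventually.
  filter_upwards [eventually_ge_atTop (Finset.univ.image x),
    hdet.eventually_ne (det_expGram_ne_zero hξ N)] with W hW hne
  exact (sum_strictAnti_det_sq_mem_range W
    (fun (i : Fin N) s => expCoeff (√ξ : ℝ) (s + (i : ℕ))) x hx
    (fun k => hW (Finset.mem_image_of_mem x (Finset.mem_univ k))) _ rfl hne).symm

open Classical in
-- Dominated convergence: a fixed diagram has at most N rows once N is large, and each prescribed
-- point it contains then occurs among its first N rows.
theorem tendsto_tsum_diagram {ξ : ℝ} (hξ : 0 ≤ ξ) {n : ℕ} (x : Fin n → ℤ) :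
    Tendsto (fun N : ℕ => ∑' lam : YoungDiagram, if lam.rowLen N = 0 then
      ((Real.exp ξ * poissonPlancherelWeight ξ lam : ℝ) : ℂ) *
        (if Set.range x ⊆ Set.range (fun i : Fin N => shiftedRow lam i) then 1 else 0) else 0) atTop
      (𝓝 ((Real.exp ξ * (poissonPlancherel ξ).real
        {lam | Set.range x ⊆ Set.range (shiftedRow lam)} : ℝ) : ℂ)) := by
  rw [poissonPlancherel_real_apply hξ, ← tsum_mul_left, Complex.ofReal_tsum]
  refine tendsto_tsum_of_dominated_convergence
    ((hasSum_poissonPlancherelWeight hξ).summable.mul_left (Real.exp ξ)) (fun lam => ?_)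
    (Eventually.of_forall fun N lam => ?_)
  · refine tendsto_const_nhds.congr' ?_
    have hev : ∀ k : Fin n, ∀ᶠ N : ℕ in atTop, x k ∈ Set.range (shiftedRow lam) →
        x k ∈ Set.range (fun i : Fin N => shiftedRow lam i) := by
      intro k
      by_cases hk : x k ∈ Set.range (shiftedRow lam)
      · obtain ⟨i, hi⟩ := hk
        filter_upwards [eventually_gt_atTop i] with N hN _ using ⟨⟨i, hN⟩, hi⟩
      · exact Eventually.of_forall fun N h => absurd h hk
    filter_upwards [eventually_ge_atTop (lam.colLen 0), eventually_all.2 hev] with N hN hk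
    have hiff : Set.range x ⊆ Set.range (fun i : Fin N => shiftedRow lam i) ↔
        Set.range x ⊆ Set.range (shiftedRow lam) := by
      constructor
      · intro h s hs
        obtain ⟨i, hi⟩ := h hs
        exact ⟨i, hi⟩
      · rintro h _ ⟨k, rfl⟩
        exact hk k (h ⟨k, rfl⟩)
    rw [if_pos (rowLen_eq_zero_of_le lam.rowLen_colLen_zero hN)]
    simp only [hiff]
    split_ifs <;> simp
  · have hnn := mul_nonneg (Real.exp_pos ξ).le (poissonPlancherelWeight_nonneg hξ lam)
    split_ifs
    · rw [mul_one, Complex.norm_real, Real.norm_of_nonneg hnn]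
    · rw [mul_zero, norm_zero]
      exact hnn
    · rw [norm_zero]
      exact hnn

/-- The correlation functions of the poissonized Plancherel measure. -/
theorem poissonPlancherel_real_range_subset {ξ : ℝ} (hξ : 0 ≤ ξ) {n : ℕ} {x : Fin n → ℤ}
    (hx : Function.Injective x) :
    (((poissonPlancherel ξ).real {lam | Set.range x ⊆ Set.range (shiftedRow lam)} : ℝ) : ℂ) =
      Matrix.det (Matrix.of fun k l : Fin n => besselSum (2 * (√ξ : ℝ)) (x k) (x l)) := by
  have hprob := isProbabilityMeasure_poissonPlancherel hξ
  have h1 := tendsto_tsum_diagram hξ x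
  simp only [(hasSum_diagram_det hξ _ hx).tsum_eq] at h1
  -- With no points the event is certain, so this case says that det G_N tends to e^ξ; the factor
  -- cancels at the end.
  have h0 := tendsto_tsum_diagram hξ (Fin.elim0 : Fin 0 → ℤ)
  have hinj : Function.Injective (Fin.elim0 : Fin 0 → ℤ) := fun i => i.elim0
  simp only [(hasSum_diagram_det hξ _ hinj).tsum_eq] at h0
  have huniv : {lam | Set.range (Fin.elim0 : Fin 0 → ℤ) ⊆ Set.range (shiftedRow lam)} =
      Set.univ := by
    ext lam
    simp
  simp only [Matrix.det_fin_zero, mul_one, huniv, probReal_univ] at h0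
  have hK : Tendsto (fun N => (Matrix.of fun k l : Fin n =>
      inner ℂ (fourierLp (T := (1 : ℝ)) 2 (x k))
          ((expSpan (√ξ : ℝ) N).starProjection (fourierLp 2 (x l))))) atTop
      (𝓝 (Matrix.of fun k l : Fin n => besselSum (2 * (√ξ : ℝ)) (x k) (x l))) :=
    tendsto_pi_nhds.2 fun k => tendsto_pi_nhds.2 fun l => tendsto_inner_starProjection _ _ _
  have h2 := tendsto_nhds_unique h1
    (h0.mul (((continuous_id.matrix_det).tendsto _).comp hK))
  rw [Complex.ofReal_mul] at h2
  exact mul_left_cancel₀ (by exact_mod_cast (Real.exp_pos ξ).ne') h2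

/-! ### Return to half-integers and the final statement -/

theorem HalfInt.floor_cast_eq (x : HalfInt) : ((⌊(x : ℝ) + 1 / 2⌋ : ℤ) : ℝ) = (x : ℝ) + 1 / 2 := by
  obtain ⟨x, k, rfl⟩ := x
  have : ((k : ℝ) + 1 / 2 + 1 / 2) = ((k + 1 : ℤ) : ℝ) := by push_cast; ring
  simp only [this, Int.floor_intCast]

theorem HalfInt.floor_injective : Function.Injective fun x : HalfInt => ⌊(x : ℝ) + 1 / 2⌋ := by
  intro x y h
  have hx := x.floor_cast_eq
  have hy := y.floor_cast_eq
  simp only at h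
  rw [h] at hx
  exact Subtype.ext (by linarith)

/-- With rows numbered from 0, the point is λ_i - i - 1/2, so adding 1/2 gives exactly the shifted
row length. -/
theorem mem_downSet_iff {lam : YoungDiagram} {x : HalfInt} :
    x ∈ downSet lam ↔ ⌊(x : ℝ) + 1 / 2⌋ ∈ Set.range (shiftedRow lam) := by
  have hx := x.floor_cast_eq
  have hiff : ∀ i : ℕ, (x : ℝ) = (lam.rowLen i : ℝ) - ((i : ℝ) + 1) + 1 / 2 ↔
      shiftedRow lam i = ⌊(x : ℝ) + 1 / 2⌋ := by
    intro i
    rw [shiftedRow, ← Int.cast_inj (α := ℝ), hx]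
    push_cast
    constructor <;> intro h <;> linarith
  exact exists_congr hiff

theorem besselKernel_eq_besselSum {R r : ℝ} (hr : 0 < r) (hrR : r < R) (ξ : ℝ) (x y : HalfInt) :
    besselKernel R r ξ x y =
      besselSum (2 * (√ξ : ℝ)) ⌊(x : ℝ) + 1 / 2⌋ ⌊(y : ℝ) + 1 / 2⌋ := by
  have hy : ⌊-(y : ℝ) + 1 / 2⌋ = 1 - ⌊(y : ℝ) + 1 / 2⌋ := by
    have h := y.floor_cast_eq
    rw [show -(y : ℝ) + 1 / 2 = ((1 - ⌊(y : ℝ) + 1 / 2⌋ : ℤ) : ℝ) by push_cast; linarith,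
      Int.floor_intCast]
  rw [besselKernel, hy, circleIntegral_circleIntegral_eq_besselSum _ hr hrR,
    inv_mul_cancel_left₀ (pow_ne_zero 2 Complex.two_pi_I_ne_zero)]

end Limit

theorem mainTheorem1 (ξ : ℝ) (hξ : 0 < ξ) :
    IsProbabilityMeasure (poissonPlancherel ξ) ∧
    ∀ R r : ℝ, 0 < r → r < R →
      (∀ (n : ℕ) (x : Fin n → HalfInt), Function.Injective x →
        (((poissonPlancherel ξ).real {lam | Set.range x ⊆ downSet lam} : ℝ) : ℂ) =
          Matrix.det (Matrix.of fun i j : Fin n => besselKernel R r ξ (x i) (x j))) ∧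
      (∀ x y : HalfInt, x ≠ y →
        besselKernel R r ξ x y =
          (√ξ : ℂ) *
            ((besselJ ⌊(x : ℝ) - 1 / 2⌋ (2 * (√ξ : ℂ)) * besselJ ⌊(y : ℝ) + 1 / 2⌋ (2 * (√ξ : ℂ)) -
              besselJ ⌊(x : ℝ) + 1 / 2⌋ (2 * (√ξ : ℂ)) * besselJ ⌊(y : ℝ) - 1 / 2⌋ (2 * (√ξ : ℂ))) /
            ((x : ℝ) - (y : ℝ) : ℂ))) := by
  refine ⟨isProbabilityMeasure_poissonPlancherel hξ.le, fun R r hr hrR => ⟨fun n x hx => ?_,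
    fun x y hxy => ?_⟩⟩
  · simp only [besselKernel_eq_besselSum hr hrR]
    refine Eq.trans ?_
      (poissonPlancherel_real_range_subset hξ.le (HalfInt.floor_injective.comp hx))
    congr 3
    ext lam
    simp only [Set.range_subset_iff, mem_downSet_iff]
  · rw [besselKernel_eq_besselSum hr hrR]
    have hfl : ∀ z : HalfInt, ⌊(z : ℝ) - 1 / 2⌋ = ⌊(z : ℝ) + 1 / 2⌋ - 1 := by
      intro z
      rw [← Int.floor_sub_one]
      congr 1
      ring
    -- Here a = x + 1/2 and b = y + 1/2, so a - b = x - y, and the argument 2√ξ turns the factor t/2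
    -- into √ξ.
    have h := sub_mul_besselSum (2 * (√ξ : ℝ)) ⌊(x : ℝ) + 1 / 2⌋ ⌊(y : ℝ) + 1 / 2⌋
    have hc : ((⌊(x : ℝ) + 1 / 2⌋ : ℂ) - (⌊(y : ℝ) + 1 / 2⌋ : ℂ)) = ((x : ℝ) - (y : ℝ) : ℂ) := by
      have hx := congrArg (fun s : ℝ => (s : ℂ)) x.floor_cast_eq
      have hy := congrArg (fun s : ℝ => (s : ℂ)) y.floor_cast_eq
      push_cast at hx hy
      rw [hx, hy]
      ring
    have hne : ((x : ℝ) - (y : ℝ) : ℂ) ≠ 0 := by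
      rw [sub_ne_zero]
      exact_mod_cast fun h => hxy (Subtype.ext h)
    rw [hc] at h
    rw [hfl, hfl, ← mul_div_assoc, eq_div_iff hne, mul_comm, h]
    ring

end
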